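/- Let $n\ge 2$, let $\Sigma^n\subseteq\mathbb R^{n+1}$ be the unit sphere and let $\operatorname{dist}(p,q)$ be its Riemannian distance, the infimum of the lengths $\int_0^1|\dot\gamma(t)|\,dt$ of the $C^1$ curves $\gamma:[0,1]\to\Sigma^n$ from $p$ to $q$. Let $a=(a_i)_{i\in\mathbb Z}$ be the mask of the linear 4-point scheme with parameter $\omega=\frac1{16}$, that is, $a_0=1$, $a_{\pm1}=\frac9{16}$, $a_{\pm3}=-\frac1{16}$ and $a_i=0$ otherwise. The Riemannian analogue $T$ of the scheme maps a sequence $x=(x_i)_{i\in\mathbb Z}$ of points of $\Sigma^n$ to the sequence $$Tx_i=\operatorname*{argmin}_{p\in\Sigma^n}\sum_{j\in\mathbb Z}a_{i-2j}\operatorname{dist}(p,x_j)^2,\qquad i\in\mathbb Z;$$ $Tx$ is called well defined if for every $i$ this minimiser over $\Sigma^n$ exists and is unique. There are constants $\mu\in(0,1)$ and $C>0$, independent of $n$ and of the data, such that for every $n\ge2$ and every sequence $x=(x_i)_{i\in\mathbb Z}$ in $\Sigma^n$ with $$\sup_{\ell\in\mathbb Z}\operatorname{dist}(x_\ell,x_{\ell+1})<0.31$$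 the following hold. 1. (Well-definedness) All iterates $T^kx$, $k\in\mathbb N$, are well defined. 2. (Contractivity) $\operatorname{dist}(T^kx_{i+1},T^kx_i)\le\mu^k\sup_\ell\operatorname{dist}(x_\ell,x_{\ell+1})$ for all $k\in\mathbb N$ and $i\in\mathbb Z$. 3. (Displacement-safety) $\operatorname{dist}(Tx_{2i},x_i)\le C\sup_\ell\operatorname{dist}(x_\ell,x_{\ell+1})$ for all $i\in\mathbb Z$. 4. (Convergence) $T$ converges for the input data $x$ to a continuous curve $f:\mathbb R\to\Sigma^n$, and $f$ is of class $C^1$. Here convergence means: for every coordinate chart $e$ of $\Sigma^n$ and every compact $K\subset\mathbb R$ such that $f(K)$ lies in the domain of $e$, for all sufficiently large $k$ the points $T^kx_i$ and $T^kx_{i+1}$ lie in the domain of $e$ whenever $[\frac{i}{2^k},\frac{i+1}{2^k})$ meets $K$, and the functions that interpolate the values $e(T^kx_i)$ at the nodes $\frac{i}{2^k}$ piecewise linearly converge to $e\circ f$ uniformly on $K$ as $k\to\infty$. -/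

import Mathlib

open Set Filter Topology

noncomputable section

namespace SphereSubdivision

/-- The unit sphere `Σⁿ ⊆ ℝⁿ⁺¹`. -/
abbrev USphere (n : ℕ) : Type := Metric.sphere (0 : EuclideanSpace ℝ (Fin (n + 1))) 1

/-- `γ` restricted to `[0,1]` is a `C¹` curve on the unit sphere from `p` to `q`. -/
structure IsSphereCurve {n : ℕ} (p q : USphere n) (γ : ℝ → EuclideanSpace ℝ (Fin (n + 1))) :
    Prop where
  contDiffOn : ContDiffOn ℝ 1 γ (Icc 0 1)
  mem_sphere : ∀ t ∈ Icc (0 : ℝ) 1, γ t ∈ Metric.sphere (0 : EuclideanSpace ℝ (Fin (n + 1))) 1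
  source : γ 0 = p
  target : γ 1 = q

/-- The length `∫₀¹ |γ'(t)| dt` of a curve parametrised over `[0,1]`. -/
def curveLength {n : ℕ} (γ : ℝ → EuclideanSpace ℝ (Fin (n + 1))) : ℝ :=
  ∫ t in (0 : ℝ)..1, ‖derivWithin γ (Icc 0 1) t‖

/-- The Riemannian distance on the unit sphere: the infimum of the lengths of the curves on the
sphere that join the two points. (The `dist` of the subtype would be the chordal distance.) -/
def rdist {n : ℕ} (p q : USphere n) : ℝ :=
  sInf {L : ℝ | ∃ γ : ℝ → EuclideanSpace ℝ (Fin (n + 1)), IsSphereCurve p q γ ∧ L = curveLength γ}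

/-- `sup_ℓ dist(x_ℓ, x_{ℓ+1})`; the distances on the sphere are bounded. -/
def mesh {n : ℕ} (x : ℤ → USphere n) : ℝ :=
  ⨆ l : ℤ, rdist (x l) (x (l + 1))

/-- The function `p ↦ ∑_j a_{i-2j} dist(p, x_j)²` (a finite sum, as masks have finite support). -/
def energy {n : ℕ} (a : ℤ → ℝ) (x : ℤ → USphere n) (i : ℤ) (p : USphere n) : ℝ :=
  ∑ᶠ j : ℤ, a (i - 2 * j) * rdist p (x j) ^ 2

/-- `p` is a minimiser over the whole sphere of `p ↦ ∑_j a_{i-2j} dist(p, x_j)²`. -/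
def IsCenter {n : ℕ} (a : ℤ → ℝ) (x : ℤ → USphere n) (i : ℤ) (p : USphere n) : Prop :=
  IsMinOn (energy a x i) univ p

/-- `Tx` is well defined: each of the minimisers that define it exists and is unique. -/
def StepWellDefined {n : ℕ} (a : ℤ → ℝ) (x : ℤ → USphere n) : Prop :=
  ∀ i : ℤ, ∃! p : USphere n, IsCenter a x i p

/-- The Riemannian analogue `T` of the linear subdivision rule with mask `a`:
`Tx_i = argmin_p ∑_j a_{i-2j} dist(p, x_j)²`. -/
def riemannianAnalogue {n : ℕ} (a : ℤ → ℝ) (x : ℤ → USphere n) : ℤ → USphere n :=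
  fun i => @Classical.epsilon (USphere n) ⟨x 0⟩ (IsCenter a x i)

/-- The mask of the 4-point scheme: `(Sx)_{2i} = x_i` and
`(Sx)_{2i+1} = -ω x_{i-1} + (1/2 + ω) x_i + (1/2 + ω) x_{i+1} - ω x_{i+2}`. -/
def fourPointMask (ω : ℝ) (i : ℤ) : ℝ :=
  if i = 0 then 1
  else if i = 1 ∨ i = -1 then 1 / 2 + ω
  else if i = 3 ∨ i = -3 then -ω
  else 0

/-- The Riemannian analogue on `Σⁿ` of the linear 4-point scheme with parameter `ω`. -/
def fourPointAnalogue {n : ℕ} (ω : ℝ) : (ℤ → USphere n) → (ℤ → USphere n) :=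
  riemannianAnalogue (fourPointMask ω)

/-- The piecewise linear function with nodes `i / 2^k` and value `y i` at `i / 2^k`. -/
def pwLinear {V : Type*} [AddCommGroup V] [Module ℝ V] (k : ℕ) (y : ℤ → V) (t : ℝ) : V :=
  AffineMap.lineMap (y ⌊2 ^ k * t⌋) (y (⌊2 ^ k * t⌋ + 1)) (Int.fract (2 ^ k * t))

/-- The refined sequences `y k = Tᵏx` converge to the continuous curve `f`. In every coordinate
chart `e`, and for every compact parameter set `K` that `f` maps into the domain of `e`, the data
points that are needed over `K` lie in the domain of `e` from some level on, and the piecewise linear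
functions in the chart with value `e (y k i)` at `i / 2^k` converge to `e ∘ f` uniformly on `K`. -/
def ConvergesTo {n : ℕ} (y : ℕ → ℤ → USphere n) (f : ℝ → USphere n) : Prop :=
  Continuous f ∧
  ∀ (e : OpenPartialHomeomorph (USphere n) (EuclideanSpace ℝ (Fin n))) (K : Set ℝ),
    IsCompact K → MapsTo f K e.source →
      (∀ᶠ k : ℕ in atTop, ∀ t ∈ K,
        y k ⌊2 ^ k * t⌋ ∈ e.source ∧ y k (⌊2 ^ k * t⌋ + 1) ∈ e.source) ∧
      TendstoUniformlyOn (fun (k : ℕ) (t : ℝ) => pwLinear k (fun i => e (y k i)) t)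
        (fun t => e (f t)) atTop K

end SphereSubdivision

end

/-! On the unit sphere `rdist` is the angle: great circles realise it, and no curve is shorter. The
proof then works with unit vectors in the ambient space and compares the rule with the linear
4-point average `S` of the same four points.

Contractivity and well-definedness. For unit `p` the chordal energy equals `‖p - S‖²` up to a
constant, because the weights sum to one, and squared angles differ from squared chords only by
fourth-order terms. Testing a minimiser `m` against `S / ‖S‖` therefore gives `‖m - S‖ ≤ 0.93 δ²`
for data of mesh at most `δ`. Since `S` is within `5/8 δ` of both middle points, `δ < 0.31` puts `m`
within `24/25 δ` of them; even entries are kept, so the mesh contracts. Existence is compactness.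
The negative weights rule out a plain convexity argument for uniqueness, so two minimisers are
compared with their spherical midpoint: the gain from the two positive weights, controlled through
convexity and slope of `arccos²`, outweighs the loss from the negative ones
(`UnitQuadruple.eq_of_isMin`).

Smoothness. The data are a linear 4-point scheme plus a defect that is quadratic in the mesh. In a
weighted norm the second differences of the derived linear scheme contract by `7/8`, while the
defect relative to the mesh decays like `(24/25)^k`. Hence the scaled first differences stay bounded
and converge geometrically to a continuous function (`exists_geometric_decay`), which is the
derivative of the limit curve (`contDiff_one_of_dyadic_differences`). -/

namespace SphereSubdivision

open InnerProductGeometry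
open scoped RealInnerProductSpace

/-! ### Angle versus chord for unit vectors -/

section Angle

variable {V : Type*} [NormedAddCommGroup V] [InnerProductSpace ℝ V]

theorem norm_sub_sq_eq_of_norm_eq_one {p q : V} (hp : ‖p‖ = 1) (hq : ‖q‖ = 1) :
    ‖p - q‖ ^ 2 = 2 - 2 * Real.cos (angle p q) := by
  rw [← inner_eq_cos_angle_of_norm_eq_one hp hq, norm_sub_sq_real, hp, hq]; ring

theorem norm_sub_eq_two_mul_sin {p q : V} (hp : ‖p‖ = 1) (hq : ‖q‖ = 1) :
    ‖p - q‖ = 2 * Real.sin (angle p q / 2) := by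
  have h0 := angle_nonneg p q
  have h1 := angle_le_pi p q
  have hs : 0 ≤ Real.sin (angle p q / 2) :=
    Real.sin_nonneg_of_nonneg_of_le_pi (by linarith) (by linarith)
  have h2 : ‖p - q‖ ^ 2 = (2 * Real.sin (angle p q / 2)) ^ 2 := by
    rw [norm_sub_sq_eq_of_norm_eq_one hp hq, mul_pow, Real.sin_sq_eq_half_sub,
      mul_div_cancel₀ _ two_ne_zero]
    ring
  exact (pow_left_inj₀ (norm_nonneg _) (by linarith) two_ne_zero).1 h2

theorem norm_sub_le_angle {p q : V} (hp : ‖p‖ = 1) (hq : ‖q‖ = 1) : ‖p - q‖ ≤ angle p q := by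
  rw [norm_sub_eq_two_mul_sin hp hq]
  have := Real.sin_le (x := angle p q / 2) (by linarith [angle_nonneg p q])
  linarith

theorem angle_sub_cube_le_norm_sub {p q : V} (hp : ‖p‖ = 1) (hq : ‖q‖ = 1) :
    angle p q - angle p q ^ 3 / 24 ≤ ‖p - q‖ := by
  rw [norm_sub_eq_two_mul_sin hp hq]
  rcases (angle_nonneg p q).eq_or_lt with h | h
  · simp [← h]
  · have := Real.sin_gt_sub_cube (x := angle p q / 2) (by linarith)
    linarith

theorem angle_le_pi_div_two_mul_norm_sub {p q : V} (hp : ‖p‖ = 1) (hq : ‖q‖ = 1) :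
    angle p q ≤ Real.pi / 2 * ‖p - q‖ := by
  rw [norm_sub_eq_two_mul_sin hp hq]
  have h := Real.mul_le_sin (x := angle p q / 2) (by linarith [angle_nonneg p q])
    (by linarith [angle_le_pi p q])
  have hpi := Real.pi_pos
  calc angle p q = Real.pi / 2 * (2 * (2 / Real.pi * (angle p q / 2))) := by field_simp
    _ ≤ _ := by gcongr

/-- Arc length exceeds chord length by at most a factor that tends to one. -/
theorem angle_le_mul_norm_sub {p q : V} (hp : ‖p‖ = 1) (hq : ‖q‖ = 1) {r : ℝ}
    (hr : ‖p - q‖ ≤ r) : (1 - r ^ 2 / 6) * angle p q ≤ ‖p - q‖ := by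
  have h0 := angle_nonneg p q
  have h1 := angle_le_pi_div_two_mul_norm_sub hp hq
  -- This crude bound turns the cubic error `angle³ / 24` into at most `r² / 6` times the angle.
  have h2 : angle p q ≤ 2 * r := by
    nlinarith [Real.pi_le_four, norm_nonneg (p - q)]
  have h3 := angle_sub_cube_le_norm_sub hp hq
  have h4 : angle p q ^ 2 ≤ (2 * r) ^ 2 := by gcongr
  nlinarith

theorem norm_sub_sq_le_angle_sq {p q : V} (hp : ‖p‖ = 1) (hq : ‖q‖ = 1) :
    ‖p - q‖ ^ 2 ≤ angle p q ^ 2 := by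
  gcongr; exact norm_sub_le_angle hp hq

/-- The squared arc length exceeds the squared chord length by a fourth-order term. -/
theorem angle_sq_le {p q : V} (hp : ‖p‖ = 1) (hq : ‖q‖ = 1) :
    angle p q ^ 2 ≤ ‖p - q‖ ^ 2 + angle p q ^ 4 / 12 := by
  have h0 := angle_nonneg p q
  have h3 := angle_sub_cube_le_norm_sub hp hq
  have h4 := norm_sub_le_angle hp hq
  nlinarith [mul_nonneg h0 (sub_nonneg.2 h3), norm_nonneg (p - q), mul_nonneg (norm_nonneg (p - q)) (sub_nonneg.2 h3), pow_nonneg h0 3, mul_nonneg (pow_nonneg h0 3) (sub_nonneg.2 h4)]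

end Angle

/-! ### The Riemannian distance is the angle -/

section Length

variable {n : ℕ}

/-- A curve on the sphere is at least as long as the angle between its end points. -/
theorem angle_le_curveLength {p q : USphere n} {γ : ℝ → EuclideanSpace ℝ (Fin (n + 1))}
    (h : IsSphereCurve p q γ) : angle (p : EuclideanSpace ℝ (Fin (n + 1))) q ≤ curveLength γ := by
  have hn : ∀ t ∈ Icc (0 : ℝ) 1, ‖γ t‖ = 1 := fun t ht => by simpa using h.mem_sphere t ht
  have hd : ContinuousOn (fun t => ‖derivWithin γ (Icc 0 1) t‖) (Icc 0 1) :=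
    (h.contDiffOn.continuousOn_derivWithin (uniqueDiffOn_Icc zero_lt_one) le_rfl).norm
  have hdu : ContinuousOn (fun t => ‖derivWithin γ (Icc 0 1) t‖) (uIcc 0 1) := by
    rwa [uIcc_of_le zero_le_one]
  have hint : IntervalIntegrable (fun t => ‖derivWithin γ (Icc 0 1) t‖) MeasureTheory.volume 0 1 :=
    hdu.intervalIntegrable
  have hγ := h.contDiffOn.continuousOn
  have hne : ∀ t ∈ Icc (0 : ℝ) 1, γ t ≠ 0 := fun t ht h0 => by simpa [h0] using hn t ht
  -- The angle from the starting point is compared with the arc length travelled. Only upper bounds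
  -- on right difference quotients are needed, so the angle, which is not smooth at coinciding or
  -- antipodal points, is never differentiated.
  have key := image_le_of_liminf_slope_right_le_deriv_boundary
    (f := fun t => angle (γ 0) (γ t)) (a := 0) (b := 1)
    (B := fun t => ∫ s in (0 : ℝ)..t, ‖derivWithin γ (Icc 0 1) s‖)
    (B' := fun t => ‖derivWithin γ (Icc 0 1) t‖)
    (fun t ht => by
      have h1 : ContinuousAt (fun y : EuclideanSpace ℝ (Fin (n + 1)) × EuclideanSpace ℝ (Fin (n + 1)) =>
          angle y.1 y.2) (γ 0, γ t) :=
        continuousAt_angle (hne 0 (by simp)) (hne t ht)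
      exact ContinuousAt.comp_continuousWithinAt (f := fun t => (γ 0, γ t)) h1
        (continuousWithinAt_const.prodMk (hγ t ht)))
    (by simp [angle_self (hne 0 (by simp))])
    (intervalIntegral.continuousOn_primitive_interval' hint (by simp) |>.mono
      (by rw [uIcc_of_le zero_le_one]))
    (fun t ht => by
      have hsub : Ici t ∩ Icc 0 1 ∈ 𝓝[Ici t] t :=
        inter_mem self_mem_nhdsWithin (mem_of_superset
          (inter_mem_nhdsWithin (Ici t) (Iio_mem_nhds ht.2)) fun s hs =>
            ⟨ht.1.trans hs.1, le_of_lt hs.2⟩)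
      have h2 : IntervalIntegrable (fun t => ‖derivWithin γ (Icc 0 1) t‖) MeasureTheory.volume 0 t :=
        hint.mono_set (by
          rw [uIcc_of_le zero_le_one, uIcc_of_le ht.1]; exact Icc_subset_Icc_right ht.2.le)
      have hc : ContinuousWithinAt (fun t => ‖derivWithin γ (Icc 0 1) t‖) (Ici t) t :=
        (hd t ⟨ht.1, ht.2.le⟩).mono_of_mem_nhdsWithin (mem_of_superset hsub inter_subset_right)
      have hioi : Icc (0 : ℝ) 1 ∈ 𝓝[>] t := 
        mem_of_superset (nhdsWithin_mono t Ioi_subset_Ici_self hsub) inter_subset_right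
      exact intervalIntegral.integral_hasDerivWithinAt_right h2
        (t := Ioi t)
        (hd.stronglyMeasurableAtFilter_nhdsWithin measurableSet_Icc t |>.filter_mono
          (nhdsWithin_le_iff.2 hioi))
        (hc.mono Ioi_subset_Ici_self))
    (fun t ht r hr => by
      have htI : t ∈ Icc (0 : ℝ) 1 := ⟨ht.1, ht.2.le⟩
      have hioi : Icc (0 : ℝ) 1 ∈ 𝓝[>] t := 
        mem_of_superset (inter_mem_nhdsWithin (Ioi t) (Iio_mem_nhds ht.2)) fun s hs =>
            ⟨ht.1.trans (le_of_lt hs.1), le_of_lt hs.2⟩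
      have hder : HasDerivWithinAt γ (derivWithin γ (Icc 0 1) t) (Ioi t) t :=
        ((h.contDiffOn.differentiableOn one_ne_zero t htI).hasDerivWithinAt).mono_of_mem_nhdsWithin hioi
      have hsl : Tendsto (fun z => ‖slope γ t z‖) (𝓝[>] t) (𝓝 ‖derivWithin γ (Icc 0 1) t‖) := by
        have := (hasDerivWithinAt_iff_tendsto_slope' (by simp)).1 hder
        exact this.norm
      have hcont : Tendsto (fun z => ‖γ t - γ z‖) (𝓝[>] t) (𝓝 0) := by
        have := (tendsto_const_nhds (x := γ t)).sub hder.continuousWithinAt.tendsto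
        simpa using this.norm
      set D := ‖derivWithin γ (Icc 0 1) t‖ with hD
      -- By the triangle inequality and the chord-arc estimate this quotient dominates the slope of
      -- the angle, and its correction factor tends to one.
      have hlim : Tendsto (fun z => ‖slope γ t z‖ / (1 - ‖γ t - γ z‖ ^ 2 / 6)) (𝓝[>] t) (𝓝 D) := by
        have := hsl.div (((hcont.pow 2).div_const 6).const_sub 1) (by norm_num)
        rw [zero_pow two_ne_zero, zero_div, sub_zero, div_one] at this
        exact this
      refine Eventually.frequently ?_
      filter_upwards [hlim.eventually_lt_const hr, hcont.eventually_lt_const zero_lt_one, hioi,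
        self_mem_nhdsWithin] with z hz hz1 hzI hzt
      refine lt_of_le_of_lt ?_ hz
      have hzt' : 0 < z - t := sub_pos.2 hzt
      have h1 := angle_le_mul_norm_sub (hn t htI) (hn z hzI) le_rfl
      have hpos : 0 < 1 - ‖γ t - γ z‖ ^ 2 / 6 := by nlinarith [norm_nonneg (γ t - γ z)]
      have h2 := angle_le_angle_add_angle (γ 0) (γ t) (γ z)
      rw [slope_def_field, slope_def_module, norm_smul, norm_inv, Real.norm_of_nonneg hzt'.le,
        norm_sub_rev (γ z), inv_mul_eq_div, div_right_comm]
      gcongr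
      rw [le_div_iff₀ hpos, mul_comm]
      refine le_trans ?_ h1
      gcongr
      linarith)
  have := key (right_mem_Icc.2 zero_le_one)
  simpa [h.source, h.target, curveLength] using this

/-- Gram–Schmidt gives the initial direction of a great circle from `p` to `q`. If `q = ±p` any
orthogonal direction serves, and one exists because `1 ≤ n`. -/
theorem exists_unit_orthogonal_combination (hn : 1 ≤ n) (p q : USphere n) :
    ∃ u : EuclideanSpace ℝ (Fin (n + 1)), ‖u‖ = 1 ∧
      ⟪(p : EuclideanSpace ℝ (Fin (n + 1))), u⟫ = 0 ∧
      (q : EuclideanSpace ℝ (Fin (n + 1))) =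
        Real.cos (angle (p : EuclideanSpace ℝ (Fin (n + 1))) q) • (p : EuclideanSpace ℝ (Fin (n + 1)))
          + Real.sin (angle (p : EuclideanSpace ℝ (Fin (n + 1))) q) • u := by
  have hp : ‖(p : EuclideanSpace ℝ (Fin (n + 1)))‖ = 1 := norm_eq_of_mem_sphere p
  have hq : ‖(q : EuclideanSpace ℝ (Fin (n + 1)))‖ = 1 := norm_eq_of_mem_sphere q
  set P : EuclideanSpace ℝ (Fin (n + 1)) := p.1
  set Q : EuclideanSpace ℝ (Fin (n + 1)) := q.1
  have hc := inner_eq_cos_angle_of_norm_eq_one hp hq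
  set θ := angle P Q
  have hw : ‖Q - Real.cos θ • P‖ ^ 2 = Real.sin θ ^ 2 := by
    rw [norm_sub_sq_real, inner_smul_right, norm_smul, real_inner_comm, hc, hp, hq, Real.sin_sq]
    simp only [Real.norm_eq_abs, mul_one, sq_abs]
    ring
  by_cases hs : Real.sin θ = 0
  · have hperp : ∃ v : EuclideanSpace ℝ (Fin (n + 1)), v ≠ 0 ∧ ⟪P, v⟫ = 0 := by
      have hP : P ≠ 0 := fun h => by simp [h] at hp
      have : Fact (Module.finrank ℝ (EuclideanSpace ℝ (Fin (n + 1))) = n + 1) := ⟨by simp⟩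
      have hrank := Submodule.finrank_orthogonal_span_singleton (𝕜 := ℝ) (n := n) hP
      have : Nontrivial (ℝ ∙ P)ᗮ := Module.nontrivial_of_finrank_pos (R := ℝ) (by omega)
      obtain ⟨v, hv⟩ := exists_ne (0 : (ℝ ∙ P)ᗮ)
      exact ⟨v, by simpa using hv, Submodule.mem_orthogonal_singleton_iff_inner_right.1 v.2⟩
    obtain ⟨v, hv, hPv⟩ := hperp
    refine ⟨‖v‖⁻¹ • v, by simp [norm_smul, hv], by simp [inner_smul_right, hPv], ?_⟩
    rw [hs, zero_smul, add_zero, ← sub_eq_zero, ← norm_eq_zero]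
    simpa [hs] using hw
  · refine ⟨(Real.sin θ)⁻¹ • (Q - Real.cos θ • P), ?_, ?_, ?_⟩
    · have h : ‖Q - Real.cos θ • P‖ = |Real.sin θ| := by
        rw [← abs_norm]; exact sq_eq_sq_iff_abs_eq_abs _ _ |>.1 hw
      rw [norm_smul, h, norm_inv, Real.norm_eq_abs, inv_mul_cancel₀ (abs_ne_zero.2 hs)]
    · rw [inner_smul_right, inner_sub_right, inner_smul_right, hc, real_inner_self_eq_norm_sq, hp]
      ring
    · rw [smul_inv_smul₀ hs]; abel

/-- The great circle arc realises the angle as a length. -/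
theorem exists_isSphereCurve_curveLength_eq (hn : 1 ≤ n) (p q : USphere n) :
    ∃ γ : ℝ → EuclideanSpace ℝ (Fin (n + 1)), IsSphereCurve p q γ ∧
      angle (p : EuclideanSpace ℝ (Fin (n + 1))) q = curveLength γ := by
  obtain ⟨u, hu, hpu, hq⟩ := exists_unit_orthogonal_combination hn p q
  have hp : ‖(p : EuclideanSpace ℝ (Fin (n + 1)))‖ = 1 := norm_eq_of_mem_sphere p
  have hθ := angle_nonneg (p : EuclideanSpace ℝ (Fin (n + 1))) q
  set P : EuclideanSpace ℝ (Fin (n + 1)) := p.1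
  set θ := angle P (q : EuclideanSpace ℝ (Fin (n + 1)))
  have hnorm : ∀ a b : ℝ, ‖a • P + b • u‖ ^ 2 = a ^ 2 + b ^ 2 := fun a b => by
    rw [norm_add_sq_real, norm_smul, norm_smul, inner_smul_left, inner_smul_right, hpu, hp, hu]
    simp
  have hder : ∀ t : ℝ, HasDerivAt (fun t : ℝ => Real.cos (t * θ) • P + Real.sin (t * θ) • u)
      ((-Real.sin (t * θ) * θ) • P + (Real.cos (t * θ) * θ) • u) t := fun t => by
    have h : HasDerivAt (fun t : ℝ => t * θ) θ t := by
      simpa using (hasDerivAt_id t).mul_const θ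
    exact (h.cos.smul_const P).add (h.sin.smul_const u)
  refine ⟨fun t => Real.cos (t * θ) • P + Real.sin (t * θ) • u, ⟨?_, ?_, ?_, ?_⟩, ?_⟩
  · apply ContDiff.contDiffOn; fun_prop
  · intro t _
    rw [mem_sphere_zero_iff_norm, ← sq_eq_sq₀ (norm_nonneg _) zero_le_one, hnorm]
    simp
  · simp [P]
  · simpa using hq.symm
  · have : EqOn (fun t => ‖derivWithin (fun t : ℝ => Real.cos (t * θ) • P + Real.sin (t * θ) • u)
        (Icc 0 1) t‖) (fun _ => θ) (uIcc 0 1) := by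
      intro t ht
      rw [uIcc_of_le zero_le_one] at ht
      simp only
      rw [(hder t).hasDerivWithinAt.derivWithin (uniqueDiffOn_Icc zero_lt_one t ht),
        ← sq_eq_sq₀ (norm_nonneg _) hθ, hnorm]
      linear_combination θ ^ 2 * Real.sin_sq_add_cos_sq (t * θ)
    rw [curveLength, intervalIntegral.integral_congr this]
    simp

/-- The case `n = 0` must be excluded: no curve joins the two points of that sphere, and the infimum
of the empty set is `0`, not `π`. -/
theorem rdist_eq_angle (hn : 1 ≤ n) (p q : USphere n) :
    rdist p q = angle (p : EuclideanSpace ℝ (Fin (n + 1))) q := by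
  obtain ⟨γ, hγ, hL⟩ := exists_isSphereCurve_curveLength_eq hn p q
  have hlb : ∀ L ∈ {L : ℝ | ∃ γ : ℝ → EuclideanSpace ℝ (Fin (n + 1)),
      IsSphereCurve p q γ ∧ L = curveLength γ}, angle (p : EuclideanSpace ℝ (Fin (n + 1))) q ≤ L := by
    rintro _ ⟨γ, hγ, rfl⟩
    exact angle_le_curveLength hγ
  exact le_antisymm (csInf_le ⟨_, hlb⟩ ⟨γ, hγ, hL⟩) (le_csInf ⟨_, γ, hγ, hL⟩ hlb)

end Length

/-! ### Slope and convexity of the squared angle as a function of the cosine -/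

section ArccosSq

theorem hasDerivAt_arccos_sq {c : ℝ} (hc : c ∈ Ioo (0 : ℝ) 1) :
    HasDerivAt (fun c => Real.arccos c ^ 2) (-2 * (Real.arccos c / √(1 - c ^ 2))) c := by
  have := (Real.hasDerivAt_arccos (x := c) (by linarith [hc.1]) hc.2.ne).pow 2
  convert! this using 1
  ring

theorem sqrt_one_sub_sq_le_arccos {c : ℝ} : √(1 - c ^ 2) ≤ Real.arccos c := by
  rw [← Real.sin_arccos]; exact Real.sin_le (Real.arccos_nonneg c)

theorem mul_arccos_le_sqrt_one_sub_sq {c : ℝ} (h0 : 0 < c) :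
    c * Real.arccos c ≤ √(1 - c ^ 2) := by
  have h := Real.le_tan (Real.arccos_nonneg c) (Real.arccos_lt_pi_div_two.2 h0)
  rw [Real.tan_arccos, le_div_iff₀ h0] at h
  linarith

theorem arccos_le_mul_sqrt {c : ℝ} (h0 : 0 ≤ c) :
    Real.arccos c ≤ Real.pi / 2 * √(1 - c ^ 2) := by
  have h := Real.mul_le_sin (Real.arccos_nonneg c) (Real.arccos_le_pi_div_two.2 h0)
  rw [Real.sin_arccos] at h
  have hpi := Real.pi_pos
  calc Real.arccos c = Real.pi / 2 * (2 / Real.pi * Real.arccos c) := by field_simp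
    _ ≤ _ := by gcongr

theorem hasDerivAt_arccos_div_sqrt {c : ℝ} (hc : c ∈ Ioo (0 : ℝ) 1) :
    HasDerivAt (fun c => Real.arccos c / √(1 - c ^ 2))
      (-((√(1 - c ^ 2) - c * Real.arccos c) / √(1 - c ^ 2) ^ 3)) c := by
  have hpos : 0 < 1 - c ^ 2 := by nlinarith [hc.1, hc.2]
  have h1 := Real.hasDerivAt_arccos (x := c) (by linarith [hc.1]) hc.2.ne
  have h2 : HasDerivAt (fun c : ℝ => 1 - c ^ 2) (-(2 * c)) c := by
    simpa using (hasDerivAt_pow 2 c).const_sub 1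
  have h3 := h1.div (h2.sqrt hpos.ne') (Real.sqrt_pos.2 hpos).ne'
  convert! h3 using 1
  have hs := (Real.sqrt_pos.2 hpos).ne'
  field_simp
  ring

theorem continuousOn_arccos_sq : ContinuousOn (fun c => Real.arccos c ^ 2) (Icc 0 1) :=
  (Real.continuous_arccos.pow 2).continuousOn

/-- With `c = cos θ` the derivative of `arccos²` is `-2 θ / sin θ`, and `θ / sin θ` lies between `1`
and `π / 2` for acute `θ`. The lower end is used here, the upper end in `monotoneOn_arccos_sq_add`.
-/
theorem antitoneOn_arccos_sq_add : AntitoneOn (fun c => Real.arccos c ^ 2 + 2 * c) (Icc 0 1) := by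
  refine antitoneOn_of_hasDerivWithinAt_nonpos (convex_Icc 0 1)
    (f' := fun c => -2 * (Real.arccos c / √(1 - c ^ 2)) + 2)
    (continuousOn_arccos_sq.add (by fun_prop)) (fun c hc => ?_) (fun c hc => ?_)
  · rw [interior_Icc] at hc ⊢
    have h := (hasDerivAt_arccos_sq hc).add ((hasDerivAt_id c).const_mul 2)
    rw [mul_one] at h
    exact h.hasDerivWithinAt
  · rw [interior_Icc] at hc
    have hpos : 0 < √(1 - c ^ 2) := Real.sqrt_pos.2 (by nlinarith [hc.1, hc.2])
    have : 1 ≤ Real.arccos c / √(1 - c ^ 2) := (one_le_div hpos).2 sqrt_one_sub_sq_le_arccos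
    linarith

theorem monotoneOn_arccos_sq_add :
    MonotoneOn (fun c => Real.arccos c ^ 2 + Real.pi * c) (Icc 0 1) := by
  refine monotoneOn_of_hasDerivWithinAt_nonneg (convex_Icc 0 1)
    (f' := fun c => -2 * (Real.arccos c / √(1 - c ^ 2)) + Real.pi)
    (continuousOn_arccos_sq.add (by fun_prop)) (fun c hc => ?_) (fun c hc => ?_)
  · rw [interior_Icc] at hc ⊢
    have h := (hasDerivAt_arccos_sq hc).add ((hasDerivAt_id c).const_mul Real.pi)
    rw [mul_one] at h
    exact h.hasDerivWithinAt
  · rw [interior_Icc] at hc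
    have hpos : 0 < √(1 - c ^ 2) := Real.sqrt_pos.2 (by nlinarith [hc.1, hc.2])
    have : Real.arccos c / √(1 - c ^ 2) ≤ Real.pi / 2 :=
      (div_le_iff₀ hpos).2 (arccos_le_mul_sqrt hc.1.le)
    linarith

theorem convexOn_arccos_sq : ConvexOn ℝ (Icc 0 1) (fun c => Real.arccos c ^ 2) := by
  refine convexOn_of_hasDerivWithinAt2_nonneg (convex_Icc 0 1) continuousOn_arccos_sq
    (f' := fun c => -2 * (Real.arccos c / √(1 - c ^ 2)))
    (f'' := fun c => -2 * (-((√(1 - c ^ 2) - c * Real.arccos c) / √(1 - c ^ 2) ^ 3)))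
    (fun c hc => ?_) (fun c hc => ?_) (fun c hc => ?_) <;> rw [interior_Icc] at hc
  · exact (hasDerivAt_arccos_sq hc).hasDerivWithinAt
  · exact ((hasDerivAt_arccos_div_sqrt hc).const_mul (-2)).hasDerivWithinAt
  · have h := mul_arccos_le_sqrt_one_sub_sq hc.1
    have : 0 ≤ (√(1 - c ^ 2) - c * Real.arccos c) / √(1 - c ^ 2) ^ 3 :=
      div_nonneg (by linarith) (by positivity)
    linarith

/-- The second derivative of `arccos²` is at most `2`: from `θ ≥ sin θ` one gets `sin θ - θ cos θ ≤
sin θ (1 - cos θ) ≤ sin³ θ`. -/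
theorem convexOn_sq_sub_arccos_sq :
    ConvexOn ℝ (Icc 0 1) (fun c => c ^ 2 - Real.arccos c ^ 2) := by
  refine convexOn_of_hasDerivWithinAt2_nonneg (convex_Icc 0 1)
    (ContinuousOn.sub (by fun_prop) continuousOn_arccos_sq)
    (f' := fun c => 2 * c - -2 * (Real.arccos c / √(1 - c ^ 2)))
    (f'' := fun c => 2 - -2 * (-((√(1 - c ^ 2) - c * Real.arccos c) / √(1 - c ^ 2) ^ 3)))
    (fun c hc => ?_) (fun c hc => ?_) (fun c hc => ?_) <;> rw [interior_Icc] at hc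
  · have h : HasDerivAt (fun c : ℝ => c ^ 2) (2 * c) c := by simpa using hasDerivAt_pow 2 c
    exact (h.sub (hasDerivAt_arccos_sq hc)).hasDerivWithinAt
  · have h : HasDerivAt (fun c : ℝ => 2 * c) 2 c := by
      simpa using (hasDerivAt_id c).const_mul 2
    exact (h.sub ((hasDerivAt_arccos_div_sqrt hc).const_mul (-2))).hasDerivWithinAt
  · have h := sqrt_one_sub_sq_le_arccos (c := c)
    have hpos : 0 < √(1 - c ^ 2) := Real.sqrt_pos.2 (by nlinarith [hc.1, hc.2])
    have hsq : √(1 - c ^ 2) ^ 2 = 1 - c ^ 2 := Real.sq_sqrt (by nlinarith [hc.1, hc.2])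
    have : (√(1 - c ^ 2) - c * Real.arccos c) / √(1 - c ^ 2) ^ 3 ≤ 1 := by
      rw [div_le_one (by positivity)]
      have h2 : c * √(1 - c ^ 2) ≤ c * Real.arccos c := by gcongr; exact hc.1.le
      have h3 : 1 - c ≤ √(1 - c ^ 2) ^ 2 := by nlinarith [hc.1, hc.2]
      nlinarith [mul_le_mul_of_nonneg_left h3 hpos.le]
    linarith

theorem midpoint_le_of_convexOn {f : ℝ → ℝ} (hf : ConvexOn ℝ (Icc 0 1) f) {x y : ℝ}
    (hx : x ∈ Icc (0 : ℝ) 1) (hy : y ∈ Icc (0 : ℝ) 1) :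
    f ((x + y) / 2) ≤ (f x + f y) / 2 := by
  obtain ⟨_, hf⟩ := hf
  have := hf hx hy (by norm_num : (0 : ℝ) ≤ 1 / 2) (by norm_num : (0 : ℝ) ≤ 1 / 2) (by norm_num)
  rw [smul_eq_mul, smul_eq_mul, smul_eq_mul, smul_eq_mul,
    show 1 / 2 * x + 1 / 2 * y = (x + y) / 2 by ring] at this
  linarith

/-- Enlarging the midpoint of two cosines decreases the squared angle at a definite rate. -/
theorem arccos_sq_le_of_midpoint_le {x y z : ℝ} (hx : x ∈ Icc (0 : ℝ) 1) (hy : y ∈ Icc (0 : ℝ) 1)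
    (hz : (x + y) / 2 ≤ z) (hz1 : z ≤ 1) :
    Real.arccos z ^ 2 ≤ (Real.arccos x ^ 2 + Real.arccos y ^ 2) / 2 - 2 * (z - (x + y) / 2) := by
  have hm : (x + y) / 2 ∈ Icc (0 : ℝ) 1 :=
    ⟨by linarith [hx.1, hy.1], by linarith [hx.2, hy.2]⟩
  have h1 := midpoint_le_of_convexOn convexOn_arccos_sq hx hy
  have h2 := antitoneOn_arccos_sq_add hm ⟨hm.1.trans hz, hz1⟩ hz
  simp only at h1 h2
  linarith

/-- The second-derivative bound limits the loss at the midpoint to `(x - y)² / 4`; moving from the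
midpoint to `z` costs at most slope `π`. -/
theorem le_arccos_sq_of_midpoint_le {x y z : ℝ} (hx : x ∈ Icc (0 : ℝ) 1) (hy : y ∈ Icc (0 : ℝ) 1)
    (hz : (x + y) / 2 ≤ z) (hz1 : z ≤ 1) :
    (Real.arccos x ^ 2 + Real.arccos y ^ 2) / 2 - (x - y) ^ 2 / 4 - Real.pi * (z - (x + y) / 2)
      ≤ Real.arccos z ^ 2 := by
  have hm : (x + y) / 2 ∈ Icc (0 : ℝ) 1 :=
    ⟨by linarith [hx.1, hy.1], by linarith [hx.2, hy.2]⟩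
  have h1 := midpoint_le_of_convexOn convexOn_sq_sub_arccos_sq hx hy
  have h2 := monotoneOn_arccos_sq_add hm ⟨hm.1.trans hz, hz1⟩ hz
  simp only at h1 h2
  linarith

end ArccosSq

/-! ### Proximity to the linear rule and contractivity -/

section FourPoints

variable {V : Type*} [NormedAddCommGroup V] [InnerProductSpace ℝ V]

/-- The function whose minimiser over the unit sphere is the point inserted between `b` and `c`. -/
noncomputable def fourPointEnergy (a b c d p : V) : ℝ :=
  9 / 16 * angle p b ^ 2 + 9 / 16 * angle p c ^ 2 - 1 / 16 * angle p a ^ 2 - 1 / 16 * angle p d ^ 2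

/-- The point that the linear 4-point scheme inserts between `b` and `c`. -/
noncomputable def fourPointAverage {V : Type*} [AddCommGroup V] [Module ℝ V] (a b c d : V) : V :=
  (9 / 16 : ℝ) • b + (9 / 16 : ℝ) • c - (1 / 16 : ℝ) • a - (1 / 16 : ℝ) • d

/-- Four unit vectors whose consecutive angles are at most `δ`. -/
structure UnitQuadruple (a b c d : V) (δ : ℝ) : Prop where
  norm_a : ‖a‖ = 1
  norm_b : ‖b‖ = 1
  norm_c : ‖c‖ = 1
  norm_d : ‖d‖ = 1
  angle_ab : angle a b ≤ δ
  angle_bc : angle b c ≤ δ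
  angle_cd : angle c d ≤ δ

variable {a b c d m : V} {δ : ℝ}

theorem UnitQuadruple.symm (h : UnitQuadruple a b c d δ) : UnitQuadruple d c b a δ :=
  ⟨h.norm_d, h.norm_c, h.norm_b, h.norm_a, by rw [angle_comm]; exact h.angle_cd,
    by rw [angle_comm]; exact h.angle_bc, by rw [angle_comm]; exact h.angle_ab⟩

theorem UnitQuadruple.nonneg (h : UnitQuadruple a b c d δ) : 0 ≤ δ :=
  (angle_nonneg _ _).trans h.angle_ab

theorem fourPointEnergy_symm (a b c d p : V) :
    fourPointEnergy d c b a p = fourPointEnergy a b c d p := by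
  unfold fourPointEnergy; ring

theorem fourPointAverage_symm {V : Type*} [AddCommGroup V] [Module ℝ V] (a b c d : V) :
    fourPointAverage d c b a = fourPointAverage a b c d := by
  unfold fourPointAverage; abel

/-- A priori localisation of a minimiser. With `s` the sum of the two angles, comparison with the
energy at `b` gives `s² / 4 - s δ / 8 ≤ 11/16 δ²`, which fails for `s > 2δ`. -/
theorem UnitQuadruple.angle_add_angle_le (h : UnitQuadruple a b c d δ)
    (hE : fourPointEnergy a b c d m ≤ fourPointEnergy a b c d b) :
    angle m b + angle m c ≤ 2 * δ := by
  have h0 := h.nonneg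
  have hb : b ≠ 0 := fun hb => by simpa [hb] using h.norm_b
  have h1 : angle m a ≤ angle m b + δ :=
    (angle_le_angle_add_angle m b a).trans (by rw [angle_comm b a]; gcongr; exact h.angle_ab)
  have h2 : angle m d ≤ angle m c + δ :=
    (angle_le_angle_add_angle m c d).trans (by gcongr; exact h.angle_cd)
  have h3 : angle m a ^ 2 ≤ (angle m b + δ) ^ 2 := by gcongr; exact angle_nonneg _ _
  have h4 : angle m d ^ 2 ≤ (angle m c + δ) ^ 2 := by gcongr; exact angle_nonneg _ _
  have h5 : angle b c ^ 2 ≤ δ ^ 2 := by gcongr; exacts [angle_nonneg _ _, h.angle_bc]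
  unfold fourPointEnergy at hE
  rw [angle_self hb] at hE
  have hx := angle_nonneg m b
  have hy := angle_nonneg m c
  by_contra hcon
  push Not at hcon
  nlinarith [sq_nonneg (angle m b - angle m c), sq_nonneg (angle b a), sq_nonneg (angle b d)]

theorem norm_sub_fourPointAverage_sq (ha : ‖a‖ = 1) (hb : ‖b‖ = 1) (hc : ‖c‖ = 1) (hd : ‖d‖ = 1)
    {p : V} (hp : ‖p‖ = 1) :
    ‖p - fourPointAverage a b c d‖ ^ 2 =
      9 / 16 * ‖p - b‖ ^ 2 + 9 / 16 * ‖p - c‖ ^ 2 - 1 / 16 * ‖p - a‖ ^ 2 - 1 / 16 * ‖p - d‖ ^ 2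
        - 1 + ‖fourPointAverage a b c d‖ ^ 2 := by
  rw [norm_sub_sq_real, norm_sub_sq_real, norm_sub_sq_real, norm_sub_sq_real, norm_sub_sq_real p d,
    ha, hb, hc, hd, hp]
  have : ⟪p, fourPointAverage a b c d⟫ =
      9 / 16 * ⟪p, b⟫ + 9 / 16 * ⟪p, c⟫ - 1 / 16 * ⟪p, a⟫ - 1 / 16 * ⟪p, d⟫ := by
    simp only [fourPointAverage, inner_sub_right, inner_add_right, inner_smul_right]
  rw [this]
  ring

/-- For weights of sum one, the squared norm of an average of unit vectors is one minus the sum of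
products of weights times squared distances over pairs. -/
theorem norm_fourPointAverage_sq (ha : ‖a‖ = 1) (hb : ‖b‖ = 1) (hc : ‖c‖ = 1) (hd : ‖d‖ = 1) :
    ‖fourPointAverage a b c d‖ ^ 2 = 1 - (81 / 256 * ‖b - c‖ ^ 2 + 1 / 256 * ‖a - d‖ ^ 2 -
      9 / 256 * (‖a - b‖ ^ 2 + ‖a - c‖ ^ 2 + ‖b - d‖ ^ 2 + ‖c - d‖ ^ 2)) := by
  have haa : ⟪a, a⟫ = 1 := by rw [real_inner_self_eq_norm_sq, ha, one_pow]
  have hbb : ⟪b, b⟫ = 1 := by rw [real_inner_self_eq_norm_sq, hb, one_pow]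
  have hcc : ⟪c, c⟫ = 1 := by rw [real_inner_self_eq_norm_sq, hc, one_pow]
  have hdd : ⟪d, d⟫ = 1 := by rw [real_inner_self_eq_norm_sq, hd, one_pow]
  simp only [← real_inner_self_eq_norm_sq, fourPointAverage, inner_sub_right, inner_add_right,
    inner_smul_right, inner_sub_left, inner_add_left, real_inner_smul_left,
    haa, hbb, hcc, hdd, real_inner_comm a b, real_inner_comm a c, real_inner_comm a d,
    real_inner_comm b c, real_inner_comm b d, real_inner_comm c d]
  ring

theorem UnitQuadruple.abs_norm_fourPointAverage_sub_one_le (h : UnitQuadruple a b c d δ)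
    (hδ : δ < 31 / 100) : |‖fourPointAverage a b c d‖ - 1| ≤ δ ^ 2 / 5 := by
  have h0 := h.nonneg
  have hab := (norm_sub_le_angle h.norm_a h.norm_b).trans h.angle_ab
  have hbc := (norm_sub_le_angle h.norm_b h.norm_c).trans h.angle_bc
  have hcd := (norm_sub_le_angle h.norm_c h.norm_d).trans h.angle_cd
  have hac : ‖a - c‖ ≤ 2 * δ := (norm_sub_le_norm_sub_add_norm_sub a b c).trans (by linarith)
  have hbd : ‖b - d‖ ≤ 2 * δ := (norm_sub_le_norm_sub_add_norm_sub b c d).trans (by linarith)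
  have had : ‖a - d‖ ≤ 3 * δ := (norm_sub_le_norm_sub_add_norm_sub a c d).trans (by linarith)
  have e1 : ‖a - b‖ ^ 2 ≤ δ ^ 2 := by gcongr
  have e2 : ‖b - c‖ ^ 2 ≤ δ ^ 2 := by gcongr
  have e3 : ‖c - d‖ ^ 2 ≤ δ ^ 2 := by gcongr
  have e4 : ‖a - c‖ ^ 2 ≤ (2 * δ) ^ 2 := by gcongr
  have e5 : ‖b - d‖ ^ 2 ≤ (2 * δ) ^ 2 := by gcongr
  have e6 : ‖a - d‖ ^ 2 ≤ (3 * δ) ^ 2 := by gcongr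
  have hN := norm_fourPointAverage_sq h.norm_a h.norm_b h.norm_c h.norm_d
  set N := ‖fourPointAverage a b c d‖
  have hN0 : 0 ≤ N := norm_nonneg _
  have p1 := sq_nonneg ‖a - b‖
  have p2 := sq_nonneg ‖b - c‖
  have p3 := sq_nonneg ‖c - d‖
  have p4 := sq_nonneg ‖a - c‖
  have p5 := sq_nonneg ‖b - d‖
  have p6 := sq_nonneg ‖a - d‖
  -- Both signs give the same constant: `81 + 9 = 90` and `9 (1 + 4 + 4 + 1) = 90`.
  have hl : 1 - 90 / 256 * δ ^ 2 ≤ N ^ 2 := by linarith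
  have hu : N ^ 2 ≤ 1 + 90 / 256 * δ ^ 2 := by linarith
  have hδ2 : δ ^ 2 ≤ 1 / 10 := by nlinarith
  have hN9 : 9 / 10 ≤ N := by nlinarith
  rw [abs_le]
  constructor <;> nlinarith

theorem UnitQuadruple.norm_fourPointAverage_sub_le (h : UnitQuadruple a b c d δ) :
    ‖fourPointAverage a b c d - b‖ ≤ 5 / 8 * δ := by
  have hab := (norm_sub_le_angle h.norm_a h.norm_b).trans h.angle_ab
  have hbc := (norm_sub_le_angle h.norm_b h.norm_c).trans h.angle_bc
  have hcd := (norm_sub_le_angle h.norm_c h.norm_d).trans h.angle_cd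
  have : fourPointAverage a b c d - b =
      -((1 / 16 : ℝ) • (a - b)) - (1 / 2 : ℝ) • (b - c) + (1 / 16 : ℝ) • (c - d) := by
    unfold fourPointAverage; module
  rw [this]
  refine (norm_add_le _ _).trans ?_
  refine (add_le_add_left (norm_sub_le _ _) _).trans ?_
  rw [norm_neg, norm_smul, norm_smul, norm_smul]
  norm_num
  linarith

/-- Proximity of the spherical and the linear 4-point rules. -/
theorem UnitQuadruple.norm_sub_fourPointAverage_le (h : UnitQuadruple a b c d δ)
    (hδ : δ < 31 / 100) (hm : ‖m‖ = 1)
    (hE : ∀ p : V, ‖p‖ = 1 → fourPointEnergy a b c d m ≤ fourPointEnergy a b c d p) :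
    ‖m - fourPointAverage a b c d‖ ≤ 93 / 100 * δ ^ 2 := by
  have h0 := h.nonneg
  have hN := h.abs_norm_fourPointAverage_sub_one_le hδ
  have hSb := h.norm_fourPointAverage_sub_le
  have hSc := h.symm.norm_fourPointAverage_sub_le
  rw [fourPointAverage_symm] at hSc
  have hident := fun p (hp : ‖p‖ = 1) =>
    norm_sub_fourPointAverage_sq h.norm_a h.norm_b h.norm_c h.norm_d (p := p) hp
  set S := fourPointAverage a b c d
  have hδ2 : δ ^ 2 ≤ 31 / 100 * δ := by nlinarith
  have hSpos : 0 < ‖S‖ := by nlinarith [(abs_le.1 hN).1]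
  have hs : ‖‖S‖⁻¹ • S‖ = 1 := by
    rw [norm_smul, norm_inv, norm_norm, inv_mul_cancel₀ hSpos.ne']
  have hsS : ‖‖S‖⁻¹ • S - S‖ ≤ δ ^ 2 / 5 := by
    have : ‖S‖⁻¹ • S - S = (1 - ‖S‖) • (‖S‖⁻¹ • S) := by
      rw [sub_smul, one_smul, smul_inv_smul₀ hSpos.ne']
    rw [this, norm_smul, hs, mul_one, Real.norm_eq_abs, abs_sub_comm]
    exact hN
  have hEs := hE _ hs
  have hsum := h.angle_add_angle_le (hE b h.norm_b)
  have hms := hident m hm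
  have hss := hident _ hs
  set s := ‖S‖⁻¹ • S
  have hquart : ∀ q : V, ‖q‖ = 1 → ‖S - q‖ ≤ 5 / 8 * δ → angle s q ^ 4 ≤ 3 / 10 * δ ^ 4 := by
    intro q hq hSq
    have h1 : ‖s - q‖ ≤ 7 / 10 * δ :=
      (norm_sub_le_norm_sub_add_norm_sub s S q).trans (by linarith)
    have h2 := angle_le_mul_norm_sub hs hq (r := 1 / 4) (by linarith)
    have h3 : angle s q ≤ 73 / 100 * δ := by nlinarith
    have h4 : angle s q ^ 4 ≤ (73 / 100 * δ) ^ 4 := by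
      gcongr; exact angle_nonneg _ _
    have := pow_nonneg h0 4
    rw [mul_pow] at h4
    linarith
  have qb := hquart b h.norm_b hSb
  have qc := hquart c h.norm_c hSc
  have hma : angle m a ≤ angle m b + δ :=
    (angle_le_angle_add_angle m b a).trans (by rw [angle_comm b a]; gcongr; exact h.angle_ab)
  have hmd : angle m d ≤ angle m c + δ :=
    (angle_le_angle_add_angle m c d).trans (by gcongr; exact h.angle_cd)
  have hfour : angle m a ^ 4 + angle m d ^ 4 ≤ 100 * δ ^ 4 := by
    have hx := angle_nonneg m b
    have hy := angle_nonneg m c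
    have h3 : angle m a ^ 2 ≤ (angle m b + δ) ^ 2 := by gcongr; exact angle_nonneg _ _
    have h4 : angle m d ^ 2 ≤ (angle m c + δ) ^ 2 := by gcongr; exact angle_nonneg _ _
    have h5 : angle m a ^ 2 + angle m d ^ 2 ≤ 10 * δ ^ 2 := by
      nlinarith [mul_nonneg hx hy]
    calc angle m a ^ 4 + angle m d ^ 4 ≤ (angle m a ^ 2 + angle m d ^ 2) ^ 2 := by
          nlinarith [mul_nonneg (sq_nonneg (angle m a)) (sq_nonneg (angle m d))]
      _ ≤ (10 * δ ^ 2) ^ 2 := by gcongr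
      _ = _ := by ring
  have l1 := norm_sub_sq_le_angle_sq hm h.norm_b
  have l2 := norm_sub_sq_le_angle_sq hm h.norm_c
  have l3 := norm_sub_sq_le_angle_sq hs h.norm_a
  have l4 := norm_sub_sq_le_angle_sq hs h.norm_d
  have u1 := angle_sq_le hs h.norm_b
  have u2 := angle_sq_le hs h.norm_c
  have u3 := angle_sq_le hm h.norm_a
  have u4 := angle_sq_le hm h.norm_d
  have hsS2 : ‖s - S‖ ^ 2 ≤ (δ ^ 2 / 5) ^ 2 := by gcongr
  -- Passing between chords and angles costs quartic terms only for the pairs `m, a`, `m, d`, `s, b`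
  -- and `s, c`; for the others `chord ≤ angle` has the right sign. The total is at most `(100/192 +
  -- 9/320 + 1/25) δ⁴`, below `0.93² δ⁴`.
  have hfin : ‖m - S‖ ^ 2 ≤ (93 / 100 * δ ^ 2) ^ 2 := by
    unfold fourPointEnergy at hEs
    have := pow_nonneg h0 4
    have e1 : (δ ^ 2 / 5) ^ 2 = δ ^ 4 / 25 := by ring
    have e2 : (93 / 100 * δ ^ 2) ^ 2 = 8649 / 10000 * δ ^ 4 := by ring
    rw [e1] at hsS2
    rw [e2]
    linarith
  exact (pow_le_pow_iff_left₀ (norm_nonneg _) (by positivity) two_ne_zero).1 hfin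

/-- Contractivity of the spherical 4-point rule. -/
theorem UnitQuadruple.angle_le_of_isMin (h : UnitQuadruple a b c d δ)
    (hδ : δ < 31 / 100) (hm : ‖m‖ = 1)
    (hE : ∀ p : V, ‖p‖ = 1 → fourPointEnergy a b c d m ≤ fourPointEnergy a b c d p) :
    angle m b ≤ 24 / 25 * δ := by
  have h0 := h.nonneg
  have h1 := h.norm_sub_fourPointAverage_le hδ hm hE
  have h2 := h.norm_fourPointAverage_sub_le
  have hδ2 : δ ^ 2 ≤ 31 / 100 * δ := by nlinarith
  -- This is where `0.31` enters: `0.93 · 0.31 + 5/8 < 0.914`.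
  have h3 : ‖m - b‖ ≤ 914 / 1000 * δ :=
    (norm_sub_le_norm_sub_add_norm_sub m (fourPointAverage a b c d) b).trans (by linarith)
  have h4 := angle_le_mul_norm_sub hm h.norm_b (r := 3 / 10) (by linarith)
  linarith

end FourPoints

/-! ### Uniqueness of the minimiser -/

section Uniqueness

variable {V : Type*} [NormedAddCommGroup V] [InnerProductSpace ℝ V]

theorem angle_eq_arccos_inner {p q : V} (hp : ‖p‖ = 1) (hq : ‖q‖ = 1) :
    angle p q = Real.arccos ⟪p, q⟫ := by
  rw [angle, hp, hq, mul_one, div_one]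

theorem one_sub_le_inner {p q : V} (hp : ‖p‖ = 1) (hq : ‖q‖ = 1) {r : ℝ} (hr : angle p q ≤ r) :
    1 - r ^ 2 / 2 ≤ ⟪p, q⟫ := by
  rw [inner_eq_cos_angle_of_norm_eq_one hp hq]
  have h1 := Real.one_sub_sq_div_two_le_cos (x := angle p q)
  have h2 : angle p q ^ 2 ≤ r ^ 2 := by gcongr; exact angle_nonneg _ _
  linarith

theorem inner_le_one {p q : V} (hp : ‖p‖ = 1) (hq : ‖q‖ = 1) : ⟪p, q⟫ ≤ 1 := by
  simpa [hp, hq] using real_inner_le_norm p q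

variable {a b c d m m' : V} {δ : ℝ}

theorem UnitQuadruple.eq_of_isMin (h : UnitQuadruple a b c d δ) (hδ : δ < 31 / 100)
    (hm : ‖m‖ = 1) (hm' : ‖m'‖ = 1)
    (hE : ∀ p : V, ‖p‖ = 1 → fourPointEnergy a b c d m ≤ fourPointEnergy a b c d p)
    (hE' : ∀ p : V, ‖p‖ = 1 → fourPointEnergy a b c d m' ≤ fourPointEnergy a b c d p) :
    m = m' := by
  have h0 := h.nonneg
  have near : ∀ m : V, ‖m‖ = 1 →
      (∀ p : V, ‖p‖ = 1 → fourPointEnergy a b c d m ≤ fourPointEnergy a b c d p) →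
      (‖m - b‖ ≤ 3 / 10 ∧ ⟪m, b⟫ ∈ Icc (9 / 10 : ℝ) 1 ∧ ⟪m, c⟫ ∈ Icc (9 / 10 : ℝ) 1) ∧
        ⟪m, a⟫ ∈ Icc (0 : ℝ) 1 ∧ ⟪m, d⟫ ∈ Icc (0 : ℝ) 1 := by
    intro m hm hE
    have hb := h.angle_le_of_isMin hδ hm hE
    have hc := h.symm.angle_le_of_isMin hδ hm (by simpa only [fourPointEnergy_symm] using hE)
    have ha : angle m a ≤ angle m b + δ :=
      (angle_le_angle_add_angle m b a).trans (by rw [angle_comm b a]; gcongr; exact h.angle_ab)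
    have hd : angle m d ≤ angle m c + δ :=
      (angle_le_angle_add_angle m c d).trans (by gcongr; exact h.angle_cd)
    have hb' := one_sub_le_inner hm h.norm_b (r := 3 / 10) (by linarith)
    have hc' := one_sub_le_inner hm h.norm_c (r := 3 / 10) (by linarith)
    have ha' := one_sub_le_inner hm h.norm_a (r := 1) (by linarith)
    have hd' := one_sub_le_inner hm h.norm_d (r := 1) (by linarith)
    exact ⟨⟨(norm_sub_le_angle hm h.norm_b).trans (by linarith),
      ⟨by linarith, inner_le_one hm h.norm_b⟩, ⟨by linarith, inner_le_one hm h.norm_c⟩⟩,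
      ⟨by linarith, inner_le_one hm h.norm_a⟩, ⟨by linarith, inner_le_one hm h.norm_d⟩⟩
  obtain ⟨⟨n1, b1, c1⟩, a1, d1⟩ := near m hm hE
  obtain ⟨⟨n2, b2, c2⟩, a2, d2⟩ := near m' hm' hE'
  by_contra hne
  have hD : 0 < ‖m - m'‖ := norm_pos_iff.2 (sub_ne_zero.2 hne)
  have hD1 : ‖m - m'‖ ≤ 6 / 10 := by
    have := norm_sub_le_norm_sub_add_norm_sub m b m'
    rw [norm_sub_rev b m'] at this
    linarith
  have hw : ‖m + m'‖ ^ 2 = 4 - ‖m - m'‖ ^ 2 := by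
    have := parallelogram_law_with_norm ℝ m m'
    rw [hm, hm'] at this
    linarith
  have hw0 : 0 < ‖m + m'‖ := by
    rcases (norm_nonneg (m + m')).eq_or_lt with h1 | h1
    · rw [← h1] at hw; nlinarith
    · exact h1
  have hw2 : ‖m + m'‖ ≤ 2 := by nlinarith
  have hs : ‖‖m + m'‖⁻¹ • (m + m')‖ = 1 := by
    rw [norm_smul, norm_inv, norm_norm, inv_mul_cancel₀ hw0.ne']
  -- Normalising the midpoint scales its inner products by `1 + κ`; gains and losses are all
  -- measured in `κ`, which is comparable to `‖m - m'‖²`.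
  obtain ⟨κ, hκ⟩ : ∃ κ, κ = 2 * ‖m + m'‖⁻¹ - 1 := ⟨_, rfl⟩
  have hκ8 : ‖m - m'‖ ^ 2 ≤ 8 * κ := by
    have h1 : ‖m + m'‖ * (κ + 1) = 2 := by rw [hκ]; field_simp; ring
    nlinarith
  have hκ0 : 0 < κ := by nlinarith
  have hz : ∀ q : V, ⟪‖m + m'‖⁻¹ • (m + m'), q⟫ - (⟪m, q⟫ + ⟪m', q⟫) / 2 =
      κ * ((⟪m, q⟫ + ⟪m', q⟫) / 2) := fun q => by
    rw [real_inner_smul_left, inner_add_left, hκ]; ring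
  set s := ‖m + m'‖⁻¹ • (m + m')
  have upper : ∀ q : V, ‖q‖ = 1 → ⟪m, q⟫ ∈ Icc (9 / 10 : ℝ) 1 → ⟪m', q⟫ ∈ Icc (9 / 10 : ℝ) 1 →
      angle s q ^ 2 ≤ (angle m q ^ 2 + angle m' q ^ 2) / 2 - 9 / 5 * κ := by
    intro q hq h1 h2
    rw [angle_eq_arccos_inner hs hq, angle_eq_arccos_inner hm hq, angle_eq_arccos_inner hm' hq]
    have h3 := arccos_sq_le_of_midpoint_le (z := ⟪s, q⟫) (Icc_subset_Icc_left (by norm_num) h1)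
      (Icc_subset_Icc_left (by norm_num) h2)
      (by rw [← sub_nonneg, hz]; nlinarith [h1.1, h2.1]) (inner_le_one hs hq)
    rw [hz] at h3
    nlinarith [h1.1, h2.1]
  have lower : ∀ q : V, ‖q‖ = 1 → ⟪m, q⟫ ∈ Icc (0 : ℝ) 1 → ⟪m', q⟫ ∈ Icc (0 : ℝ) 1 →
      (angle m q ^ 2 + angle m' q ^ 2) / 2 - 6 * κ ≤ angle s q ^ 2 := by
    intro q hq h1 h2
    rw [angle_eq_arccos_inner hs hq, angle_eq_arccos_inner hm hq, angle_eq_arccos_inner hm' hq]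
    have h3 := le_arccos_sq_of_midpoint_le (z := ⟪s, q⟫) h1 h2
      (by rw [← sub_nonneg, hz]; nlinarith [h1.1, h2.1]) (inner_le_one hs hq)
    rw [hz] at h3
    have h4 : (⟪m, q⟫ - ⟪m', q⟫) ^ 2 ≤ ‖m - m'‖ ^ 2 := by
      rw [← inner_sub_left, sq_le_sq, abs_norm]
      simpa [hq] using abs_real_inner_le_norm (m - m') q
    have h5 : Real.pi * (κ * ((⟪m, q⟫ + ⟪m', q⟫) / 2)) ≤ 4 * (κ * 1) := by
      gcongr
      · have := h1.1; have := h2.1; positivity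
      · exact Real.pi_le_four
      · linarith [h1.2, h2.2]
    linarith
  -- The energy at `s` is below the mean of the two minima by at least `(9/16 · 2 · 9/5 - 1/16 · 2 ·
  -- 6) κ > 0`, a contradiction.
  have e1 := hE s hs
  have e2 := hE' s hs
  have ub := upper b h.norm_b b1 b2
  have uc := upper c h.norm_c c1 c2
  have la := lower a h.norm_a a1 a2
  have ld := lower d h.norm_d d1 d2
  unfold fourPointEnergy at e1 e2
  linarith

end Uniqueness

/-! ### Limits of dyadic data and their differentiability -/

section DyadicLimit

theorem floor_two_mul (y : ℝ) : ⌊2 * y⌋ = 2 * ⌊y⌋ ∨ ⌊2 * y⌋ = 2 * ⌊y⌋ + 1 := by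
  have h1 := Int.floor_le y
  have h2 := Int.lt_floor_add_one y
  have h3 : 2 * ⌊y⌋ ≤ ⌊2 * y⌋ := Int.le_floor.2 (by push_cast; linarith)
  have h4 : ⌊2 * y⌋ < 2 * ⌊y⌋ + 2 := Int.floor_lt.2 (by push_cast; linarith)
  omega

theorem floor_eq_or_of_abs_sub_lt_one {x y : ℝ} (h : |x - y| < 1) :
    ⌊x⌋ = ⌊y⌋ ∨ ⌊x⌋ = ⌊y⌋ + 1 ∨ ⌊y⌋ = ⌊x⌋ + 1 := by
  obtain ⟨h1, h2⟩ := abs_lt.1 h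
  have h3 : ⌊x⌋ < ⌊y⌋ + 2 := Int.floor_lt.2 (by push_cast; linarith [Int.lt_floor_add_one y])
  have h4 : ⌊y⌋ < ⌊x⌋ + 2 := Int.floor_lt.2 (by push_cast; linarith [Int.lt_floor_add_one x])
  omega

/-- Dyadic data whose refinements and consecutive differences decay geometrically have a
continuous limit. -/
theorem exists_continuous_dyadic_limit {X : Type*} [MetricSpace X] [CompleteSpace X]
    {a : ℕ → ℤ → X} {C r : ℝ} (hr0 : 0 ≤ r) (hr1 : r < 1)
    (heven : ∀ k i, dist (a (k + 1) (2 * i)) (a k i) ≤ C * r ^ k)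
    (hodd : ∀ k i, dist (a (k + 1) (2 * i + 1)) (a k i) ≤ C * r ^ k)
    (hstep : ∀ k i, dist (a k (i + 1)) (a k i) ≤ C * r ^ k) :
    ∃ f : ℝ → X, Continuous f ∧
      ∀ k t, dist (a k ⌊2 ^ k * t⌋) (f t) ≤ C * r ^ k / (1 - r) := by
  have hu : ∀ t : ℝ, ∀ k : ℕ,
      dist (a k ⌊2 ^ k * t⌋) (a (k + 1) ⌊2 ^ (k + 1) * t⌋) ≤ C * r ^ k := by
    intro t k
    rw [dist_comm, pow_succ', mul_assoc]
    rcases floor_two_mul (2 ^ k * t) with h | h <;> rw [h]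
    exacts [heven _ _, hodd _ _]
  choose f hf using fun t : ℝ => cauchySeq_tendsto_of_complete
    (cauchySeq_of_le_geometric r C hr1 (hu t))
  have hdist : ∀ k t, dist (a k ⌊2 ^ k * t⌋) (f t) ≤ C * r ^ k / (1 - r) := fun k t =>
    dist_le_of_le_geometric_of_tendsto r C hr1 (hu t) (hf t) k
  have hC : 0 ≤ C := by simpa using dist_nonneg.trans (hstep 0 0)
  refine ⟨f, Metric.continuous_iff.2 fun t ε hε => ?_, hdist⟩
  have hlim : Tendsto (fun k : ℕ => C * r ^ k / (1 - r) + C * r ^ k + C * r ^ k / (1 - r)) atTop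
      (𝓝 0) := by
    have h := (tendsto_pow_atTop_nhds_zero_of_lt_one hr0 hr1).const_mul C
    rw [mul_zero] at h
    simpa using ((h.div_const (1 - r)).add h).add (h.div_const (1 - r))
  obtain ⟨k, hk⟩ := (hlim.eventually_lt_const hε).exists
  refine ⟨1 / 2 ^ k, by positivity, fun s hs => lt_of_le_of_lt ?_ hk⟩
  have hfl : dist (a k ⌊2 ^ k * s⌋) (a k ⌊2 ^ k * t⌋) ≤ C * r ^ k := by
    have : |2 ^ k * s - 2 ^ k * t| < 1 := by
      rw [← mul_sub, abs_mul, abs_of_pos (by positivity : (0 : ℝ) < 2 ^ k)]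
      rwa [Real.dist_eq, lt_div_iff₀' (by positivity)] at hs
    rcases floor_eq_or_of_abs_sub_lt_one this with h | h | h
    · rw [h, dist_self]; positivity
    · rw [h]; exact hstep _ _
    · rw [h, dist_comm]; exact hstep _ _
  calc dist (f s) (f t) ≤ dist (f s) (a k ⌊2 ^ k * s⌋) + dist (a k ⌊2 ^ k * s⌋) (a k ⌊2 ^ k * t⌋)
        + dist (a k ⌊2 ^ k * t⌋) (f t) := dist_triangle4 _ _ _ _
    _ ≤ _ := by
      rw [dist_comm (f s)]
      gcongr
      exacts [hdist k s, hdist k t]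

theorem interpolatory_iterate {X : Type*} {a : ℕ → ℤ → X}
    (ha : ∀ k i, a (k + 1) (2 * i) = a k i) (k m : ℕ) (i : ℤ) :
    a (k + m) (2 ^ m * i) = a k i := by
  induction m with
  | zero => simp
  | succ m ih => rw [← add_assoc, pow_succ', mul_assoc, ha, ih]

/-- The limit of an interpolatory scheme takes the data as its dyadic values. -/
theorem dyadic_limit_apply {X : Type*} [MetricSpace X] {a : ℕ → ℤ → X} {f : ℝ → X} {C r : ℝ}
    (hr0 : 0 ≤ r) (hr1 : r < 1) (ha : ∀ k i, a (k + 1) (2 * i) = a k i)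
    (hf : ∀ k t, dist (a k ⌊2 ^ k * t⌋) (f t) ≤ C * r ^ k / (1 - r)) (k : ℕ) (i : ℤ) :
    f (i / 2 ^ k) = a k i := by
  have h : ∀ m : ℕ, dist (a k i) (f (i / 2 ^ k)) ≤ C * r ^ (k + m) / (1 - r) := by
    intro m
    have h1 := hf (k + m) (i / 2 ^ k)
    have h2 : (2 : ℝ) ^ (k + m) * (i / 2 ^ k) = ((2 ^ m * i : ℤ) : ℝ) := by
      push_cast; rw [pow_add]; field_simp
    rwa [h2, Int.floor_intCast, interpolatory_iterate ha] at h1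
  have hlim : Tendsto (fun m : ℕ => C * r ^ (k + m) / (1 - r)) atTop (𝓝 0) := by
    have h1 := (tendsto_pow_atTop_nhds_zero_of_lt_one hr0 hr1).comp
      (tendsto_add_atTop_nat k)
    simpa [Function.comp_def, add_comm] using (h1.const_mul C).div_const (1 - r)
  exact (dist_le_zero.1 (ge_of_tendsto' hlim h)).symm

/-- A dyadic function whose scaled differences converge to a continuous function is `C¹`. -/
theorem contDiff_one_of_dyadic_differences {V : Type*} [NormedAddCommGroup V] [NormedSpace ℝ V]
    [CompleteSpace V] {p : ℕ → ℤ → V} {f g : ℝ → V} {C r : ℝ} (hr0 : 0 ≤ r) (hr1 : r < 1)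
    (hf : Continuous f) (hg : Continuous g) (hfp : ∀ (k : ℕ) (i : ℤ), f (i / 2 ^ k) = p k i)
    (hgp : ∀ (k : ℕ) (t : ℝ),
      dist ((2 : ℝ) ^ k • (p k (⌊2 ^ k * t⌋ + 1) - p k ⌊2 ^ k * t⌋)) (g t) ≤ C * r ^ k) :
    ContDiff ℝ 1 f := by
  -- The goal is that `h` is constant, so that `g` is the derivative of `f`.
  set h : ℝ → V := fun t => f t - ∫ s in (0 : ℝ)..t, g s with hh
  have hint : ∀ a b, IntervalIntegrable g MeasureTheory.volume a b := fun a b =>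
    hg.intervalIntegrable a b
  have hder : ∀ t, HasDerivAt (fun t => ∫ s in (0 : ℝ)..t, g s) (g t) t := fun t =>
    hg.integral_hasStrictDerivAt 0 t |>.hasDerivAt
  have hhc : Continuous h :=
    hf.sub (continuous_iff_continuousAt.2 fun t => (hder t).continuousAt)
  have hstep : ∀ (k : ℕ) (i : ℤ),
      ‖h ((i + 1 : ℤ) / 2 ^ k) - h (i / 2 ^ k)‖ ≤ C * r ^ k / 2 ^ k := by
    intro k i
    have h2 : (0 : ℝ) < 2 ^ k := by positivity
    have hlt : (i : ℝ) / 2 ^ k < (i + 1 : ℤ) / 2 ^ k := by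
      push_cast; gcongr; linarith
    have hlen : ((i + 1 : ℤ) : ℝ) / 2 ^ k - i / 2 ^ k = 1 / 2 ^ k := by push_cast; ring
    set D := (2 : ℝ) ^ k • (p k (i + 1) - p k i) with hD
    -- The floor equals `i` only on the half-open interval; continuity of `g` adds the right end
    -- point.
    have hbd : ∀ t ∈ Icc ((i : ℝ) / 2 ^ k) ((i + 1 : ℤ) / 2 ^ k), ‖D - g t‖ ≤ C * r ^ k := by
      have hcl : IsClosed {t | ‖D - g t‖ ≤ C * r ^ k} :=
        isClosed_le (continuous_const.sub hg).norm continuous_const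
      rw [← closure_Ico hlt.ne]
      refine closure_minimal (fun t ht => ?_) hcl
      have hfl : ⌊2 ^ k * t⌋ = i := by
        rw [Int.floor_eq_iff]
        have h3 := (div_le_iff₀' h2).1 ht.1
        have h4 := (lt_div_iff₀' h2).1 ht.2
        push_cast at h4
        exact ⟨h3, h4⟩
      have h5 := hgp k t
      rwa [hfl, dist_eq_norm] at h5
    have heq : h ((i + 1 : ℤ) / 2 ^ k) - h (i / 2 ^ k) =
        ∫ s in ((i : ℝ) / 2 ^ k)..((i + 1 : ℤ) / 2 ^ k), (D - g s) := by
      rw [intervalIntegral.integral_sub intervalIntegrable_const (hint _ _),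
        intervalIntegral.integral_const, hlen, hD, one_div, inv_smul_smul₀ h2.ne',
        ← intervalIntegral.integral_interval_sub_left (hint 0 _) (hint 0 _), hh]
      simp only [hfp]
      abel
    rw [heq]
    refine (intervalIntegral.norm_integral_le_of_norm_le_const (C := C * r ^ k) fun t ht => ?_).trans
      (le_of_eq ?_)
    · rw [uIoc_of_le hlt.le] at ht
      exact hbd t (Ioc_subset_Icc_self ht)
    · rw [hlen, abs_of_pos (by positivity)]; ring
  have hsteps : ∀ (k : ℕ) (i : ℤ) (j : ℕ),
      ‖h ((i + j : ℤ) / 2 ^ k) - h (i / 2 ^ k)‖ ≤ j * (C * r ^ k / 2 ^ k) := by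
    intro k i j
    induction j with
    | zero => simp
    | succ j ih =>
      have h1 := hstep k (i + j)
      rw [add_assoc] at h1
      push_cast at h1 ih ⊢
      calc _ ≤ _ := norm_sub_le_norm_sub_add_norm_sub _ (h ((i + j) / 2 ^ k)) _
        _ ≤ _ := add_le_add h1 ih
        _ = _ := by ring
  -- Splitting a level `m` interval into `2 ^ k` pieces cancels the denominator `2 ^ k` and leaves
  -- the factor `r ^ (m + k)`, which tends to zero.
  have hsucc : ∀ (m : ℕ) (i : ℤ), h ((i + 1 : ℤ) / 2 ^ m) = h (i / 2 ^ m) := by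
    intro m i
    have hb : ∀ k : ℕ, ‖h ((i + 1 : ℤ) / 2 ^ m) - h (i / 2 ^ m)‖ ≤ C * r ^ (m + k) / 2 ^ m := by
      intro k
      have h1 := hsteps (m + k) (2 ^ k * i) (2 ^ k)
      have e1 : ((2 ^ k * i : ℤ) : ℝ) / 2 ^ (m + k) = i / 2 ^ m := by
        push_cast; rw [pow_add]; field_simp
      have e2 : ((2 ^ k * i + (2 ^ k : ℕ) : ℤ) : ℝ) / 2 ^ (m + k) = (i + 1 : ℤ) / 2 ^ m := by
        push_cast; rw [pow_add]; field_simp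
      have e3 : ((2 ^ k : ℕ) : ℝ) * (C * r ^ (m + k) / 2 ^ (m + k)) = C * r ^ (m + k) / 2 ^ m := by
        push_cast; rw [pow_add 2 m k]; field_simp
      rwa [e1, e2, e3] at h1
    have hlim : Tendsto (fun k : ℕ => C * r ^ (m + k) / 2 ^ m) atTop (𝓝 0) := by
      have h1 := (tendsto_pow_atTop_nhds_zero_of_lt_one hr0 hr1).comp
        (tendsto_add_atTop_nat m)
      simpa [Function.comp_def, add_comm] using (h1.const_mul C).div_const (2 ^ m)
    exact sub_eq_zero.1 (norm_le_zero_iff.1 (ge_of_tendsto' hlim hb))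
  have hdy : ∀ (m : ℕ) (i : ℤ), h (i / 2 ^ m) = h 0 := by
    intro m i
    induction i using Int.induction_on with
    | zero => simp
    | succ i ih => rw [hsucc, ih]
    | pred i ih => rw [← ih, ← hsucc m (-i - 1), sub_add_cancel]
  have hconst : ∀ t, h t = h 0 := by
    intro t
    have hlim : Tendsto (fun m : ℕ => (⌊2 ^ m * t⌋ : ℝ) / 2 ^ m) atTop (𝓝 t) := by
      have h0 : Tendsto (fun m : ℕ => t - (1 / 2 : ℝ) ^ m) atTop (𝓝 t) := by
        simpa using (tendsto_pow_atTop_nhds_zero_of_lt_one (r := (1 / 2 : ℝ)) (by norm_num)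
          (by norm_num)).const_sub t
      refine tendsto_of_tendsto_of_tendsto_of_le_of_le h0 tendsto_const_nhds (fun m => ?_)
        (fun m => ?_)
      · have h1 := Int.lt_floor_add_one (2 ^ m * t)
        simp only
        rw [le_div_iff₀ (by positivity), sub_mul, ← mul_pow]
        norm_num
        linarith
      · exact (div_le_iff₀' (by positivity)).2 (Int.floor_le _)
    have h1 := (hhc.tendsto t).comp hlim
    exact tendsto_nhds_unique h1 (tendsto_const_nhds.congr fun m => (hdy m _).symm)
  have hfder : ∀ t, HasDerivAt f (g t) t := by
    intro t
    have h1 : f = fun t => h 0 + ∫ s in (0 : ℝ)..t, g s := by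
      funext t
      rw [← hconst t, hh]
      simp
    rw [h1]
    exact (hder t).const_add _
  rw [contDiff_one_iff_deriv]
  refine ⟨fun t => (hfder t).differentiableAt, ?_⟩
  rwa [show deriv f = g from funext fun t => (hfder t).deriv]

end DyadicLimit

/-! ### The perturbed derived scheme -/

section Decay

variable {V : Type*} [NormedAddCommGroup V]

/-- Bounds for the first and second differences; the second ones carry a weight that makes the
4-point scheme contractive in a single step. -/
structure DiffBound (D : ℤ → V) (A N : ℝ) : Prop where
  first : ∀ i, ‖D i‖ ≤ A
  even : ∀ i, ‖D (2 * i + 1) - D (2 * i)‖ ≤ N / 2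
  odd : ∀ i, ‖D (2 * i + 1 + 1) - D (2 * i + 1)‖ ≤ N

variable {D D' ε : ℤ → V} {A N η : ℝ}

theorem DiffBound.nonneg (h : DiffBound D A N) : 0 ≤ A ∧ 0 ≤ N :=
  ⟨(norm_nonneg _).trans (h.first 0), (norm_nonneg _).trans (h.odd 0)⟩

theorem DiffBound.second_le (h : DiffBound D A N) (i : ℤ) : ‖D (i + 1) - D i‖ ≤ N := by
  obtain ⟨j, rfl | rfl⟩ := Int.even_or_odd' i
  · linarith [h.even j, h.nonneg.2]
  · exact h.odd j

theorem DiffBound.add_le (h : DiffBound D A N) (i : ℤ) :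
    ‖D i - D (i - 1)‖ + ‖D (i + 1) - D i‖ ≤ 3 / 2 * N := by
  obtain ⟨j, rfl | rfl⟩ := Int.even_or_odd' i
  · have h1 := h.even j
    have h2 := h.odd (j - 1)
    rw [show 2 * (j - 1) + 1 + 1 = 2 * j by ring, show 2 * (j - 1) + 1 = 2 * j - 1 by ring] at h2
    linarith
  · have h1 := h.even j
    have h2 := h.odd j
    rw [show 2 * j + 1 - 1 = 2 * j by ring]
    linarith

/-- In the plain supremum norm the coefficients `3/4 + 1/8 + 1/8` give no contraction. Since
adjacent second differences sum to at most `3/2 N`, the total here is at most `2 · 1/8 · 3/2 N + 1/2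
N`. -/
theorem DiffBound.weighted_le (h : DiffBound D A N) (i : ℤ) :
    3 / 4 * ‖D (i + 1) - D i‖ + 1 / 8 * ‖D i - D (i - 1)‖ + 1 / 8 * ‖D (i + 2) - D (i + 1)‖
      ≤ 7 / 8 * N := by
  have h1 := h.add_le i
  have h2 := h.add_le (i + 1)
  rw [add_sub_cancel_right, add_assoc, one_add_one_eq_two] at h2
  linarith [h.second_le i]

theorem DiffBound.norm_sub_two_le (h : DiffBound D A N) (i : ℤ) :
    ‖D (i - 1) - D (i + 1)‖ ≤ 3 / 2 * N := by
  have h1 := norm_sub_le_norm_sub_add_norm_sub (D (i + 1)) (D i) (D (i - 1))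
  rw [norm_sub_rev]
  linarith [h.add_le i]

variable [NormedSpace ℝ V]

/-- The derived 4-point scheme, perturbed by `ε`, stays close to its data. -/
theorem DiffBound.dist_le (h : DiffBound D A N) (hε : ∀ i, ‖ε i‖ ≤ η)
    (heven : ∀ i, D' (2 * i) = D i + (1 / 8 : ℝ) • (D (i - 1) - D (i + 1)) + ε i)
    (hodd : ∀ i, D' (2 * i + 1) = D i - (1 / 8 : ℝ) • (D (i - 1) - D (i + 1)) - ε i) (i : ℤ) :
    dist (D' (2 * i)) (D i) ≤ 3 / 16 * N + η ∧ dist (D' (2 * i + 1)) (D i) ≤ 3 / 16 * N + η := by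
  have h1 : ‖(1 / 8 : ℝ) • (D (i - 1) - D (i + 1)) + ε i‖ ≤ 3 / 16 * N + η := by
    refine (norm_add_le _ _).trans (add_le_add ?_ (hε i))
    rw [norm_smul]
    norm_num
    linarith [h.norm_sub_two_le i]
  constructor
  · rwa [dist_eq_norm, heven, add_assoc, add_sub_cancel_left]
  · rwa [dist_eq_norm, hodd, sub_sub (D i), sub_sub_cancel_left, norm_neg]

/-- The new second differences inside a refined interval are at most `3/8 N + 2η`, within half of
the new bound; those across a node are handled by `DiffBound.weighted_le`. This preserves the
weights. -/
theorem DiffBound.refine (h : DiffBound D A N) (hε : ∀ i, ‖ε i‖ ≤ η)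
    (heven : ∀ i, D' (2 * i) = D i + (1 / 8 : ℝ) • (D (i - 1) - D (i + 1)) + ε i)
    (hodd : ∀ i, D' (2 * i + 1) = D i - (1 / 8 : ℝ) • (D (i - 1) - D (i + 1)) - ε i) :
    DiffBound D' (A + 3 / 16 * N + η) (7 / 8 * N + 4 * η) := by
  have h0 := h.nonneg
  have hη : 0 ≤ η := (norm_nonneg _).trans (hε 0)
  refine ⟨fun i => ?_, fun i => ?_, fun i => ?_⟩
  · have hd := h.dist_le hε heven hodd
    obtain ⟨j, rfl | rfl⟩ := Int.even_or_odd' i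
    · have h1 := norm_le_norm_add_norm_sub' (D' (2 * j)) (D j)
      have h2 := (hd j).1
      rw [dist_eq_norm] at h2
      linarith [h.first j]
    · have h1 := norm_le_norm_add_norm_sub' (D' (2 * j + 1)) (D j)
      have h2 := (hd j).2
      rw [dist_eq_norm] at h2
      linarith [h.first j]
  · have e : D' (2 * i + 1) - D' (2 * i) =
        -((1 / 4 : ℝ) • (D (i - 1) - D (i + 1))) - (2 : ℝ) • ε i := by
      rw [heven, hodd]; module
    rw [e]
    refine (norm_sub_le _ _).trans ?_
    rw [norm_neg, norm_smul, norm_smul]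
    norm_num
    linarith [h.norm_sub_two_le i, hε i]
  · have e : D' (2 * i + 1 + 1) - D' (2 * i + 1) =
        (3 / 4 : ℝ) • (D (i + 1) - D i) - (1 / 8 : ℝ) • (D i - D (i - 1))
          - (1 / 8 : ℝ) • (D (i + 2) - D (i + 1)) + ε (i + 1) + ε i := by
      rw [show 2 * i + 1 + 1 = 2 * (i + 1) by ring, heven, hodd, add_sub_cancel_right,
        show i + 1 + 1 = i + 2 by ring]
      module
    rw [e]
    have h1 := h.weighted_le i
    have h2 := norm_sub_le ((3 / 4 : ℝ) • (D (i + 1) - D i)) ((1 / 8 : ℝ) • (D i - D (i - 1)))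
    have h3 := norm_sub_le ((3 / 4 : ℝ) • (D (i + 1) - D i) - (1 / 8 : ℝ) • (D i - D (i - 1)))
      ((1 / 8 : ℝ) • (D (i + 2) - D (i + 1)))
    rw [norm_smul, norm_smul] at h2
    rw [norm_smul (1 / 8 : ℝ) (D (i + 2) - D (i + 1))] at h3
    norm_num at h2 h3
    refine (norm_add₃_le).trans ?_
    norm_num
    linarith [hε i, hε (i + 1)]

/-- The differences of the level `k` data, scaled by the density of the dyadic points. -/
noncomputable def scaledDiff (p : ℕ → ℤ → V) (k : ℕ) (i : ℤ) : V :=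
  (2 : ℝ) ^ k • (p k (i + 1) - p k i)

variable {p : ℕ → ℤ → V} {q : ℝ}

theorem scaledDiff_succ_even (hp : ∀ k i, p (k + 1) (2 * i) = p k i) (k : ℕ) (i : ℤ) :
    scaledDiff p (k + 1) (2 * i) =
      scaledDiff p k i + (1 / 8 : ℝ) • (scaledDiff p k (i - 1) - scaledDiff p k (i + 1)) +
      (2 : ℝ) ^ (k + 1) • (p (k + 1) (2 * i + 1) -
        fourPointAverage (p k (i - 1)) (p k i) (p k (i + 1)) (p k (i + 2))) := by
  simp only [scaledDiff, fourPointAverage, hp, pow_succ, sub_add_cancel,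
    show i + 1 + 1 = i + 2 by ring]
  module

theorem scaledDiff_succ_odd (hp : ∀ k i, p (k + 1) (2 * i) = p k i) (k : ℕ) (i : ℤ) :
    scaledDiff p (k + 1) (2 * i + 1) =
      scaledDiff p k i - (1 / 8 : ℝ) • (scaledDiff p k (i - 1) - scaledDiff p k (i + 1)) -
      (2 : ℝ) ^ (k + 1) • (p (k + 1) (2 * i + 1) -
        fourPointAverage (p k (i - 1)) (p k i) (p k (i + 1)) (p k (i + 2))) := by
  simp only [scaledDiff, fourPointAverage, show 2 * i + 1 + 1 = 2 * (i + 1) by ring, hp, pow_succ,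
    sub_add_cancel, show i + 1 + 1 = i + 2 by ring]
  module

theorem sum_geometric_le {q : ℝ} (hq0 : 0 ≤ q) (hq1 : q < 1) (k : ℕ) :
    ∑ j ∈ Finset.range k, q ^ j ≤ (1 - q)⁻¹ := by
  rw [← tsum_geometric_of_lt_one hq0 hq1]
  exact (summable_geometric_of_lt_one hq0 hq1).sum_le_tsum _ fun _ _ => by positivity

/-- A perturbation of the 4-point scheme whose defect is of higher order has scaled differences
that converge geometrically. -/
theorem exists_geometric_decay (hq : 7 / 8 < q) (hq1 : q < 1)
    (hp : ∀ k i, p (k + 1) (2 * i) = p k i) {B : ℝ} (hB : ∀ i, ‖p 0 (i + 1) - p 0 i‖ ≤ B)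
    (hprox : ∀ (k : ℕ) (b : ℝ), (∀ i, ‖p k (i + 1) - p k i‖ ≤ b) → ∀ i,
      ‖p (k + 1) (2 * i + 1) - fourPointAverage (p k (i - 1)) (p k i) (p k (i + 1)) (p k (i + 2))‖
        ≤ q ^ k * b) :
    ∃ C : ℝ, (∀ k i, dist (scaledDiff p (k + 1) (2 * i)) (scaledDiff p k i) ≤ C * q ^ k) ∧
      (∀ k i, dist (scaledDiff p (k + 1) (2 * i + 1)) (scaledDiff p k i) ≤ C * q ^ k) ∧
      ∀ k i, dist (scaledDiff p k (i + 1)) (scaledDiff p k i) ≤ C * q ^ k := by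
  have hq0 : 0 < q := by linarith
  have hB0 : 0 ≤ B := (norm_nonneg _).trans (hB 0)
  have herr : ∀ {k A N}, DiffBound (scaledDiff p k) A N → ∀ i,
      ‖(2 : ℝ) ^ (k + 1) • (p (k + 1) (2 * i + 1) -
        fourPointAverage (p k (i - 1)) (p k i) (p k (i + 1)) (p k (i + 2)))‖ ≤ 2 * (q ^ k * A) := by
    intro k A N h i
    have h2 : (0 : ℝ) < 2 ^ k := by positivity
    have h1 := hprox k (A / 2 ^ k) (fun i => by
      have := h.first i
      rw [scaledDiff, norm_smul, norm_pow, Real.norm_ofNat] at this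
      exact (le_div_iff₀' h2).2 this) i
    rw [norm_smul, norm_pow, Real.norm_ofNat]
    calc _ ≤ (2 : ℝ) ^ (k + 1) * (q ^ k * (A / 2 ^ k)) := by gcongr
      _ = _ := by rw [pow_succ]; field_simp
  -- With defect `2 q^k A`, one step multiplies `A + 3/2 N` by at most `1 + 14 q^k`: `3/16 + 3/2 ·
  -- 7/8 = 3/2` and `2 + 3/2 · 8 = 14`. The initial value is `B + 3/2 · 4B = 7B`.
  set M := 7 * B * Real.exp (14 * (1 - q)⁻¹) with hM
  -- Chosen so that `7/8 K + 8 M ≤ K q`, which propagates `N ≤ K q^k`; the summand `M` covers the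
  -- start `N = 4B`.
  set K := M + 8 * M / (q - 7 / 8) with hK
  have hM0 : 0 ≤ M := by positivity
  have hK8 : 8 * M ≤ K * (q - 7 / 8) := by
    have : 0 < q - 7 / 8 := by linarith
    rw [hK, add_mul, div_mul_cancel₀ _ this.ne']
    nlinarith
  have hMK : M ≤ K := by
    have : 0 < q - 7 / 8 := by linarith
    rw [hK]; linarith [show 0 ≤ 8 * M / (q - 7 / 8) by positivity]
  have hbound : ∀ k : ℕ, ∃ A N, DiffBound (scaledDiff p k) A N ∧
      A + 3 / 2 * N ≤ 7 * B * Real.exp (14 * ∑ j ∈ Finset.range k, q ^ j) ∧ N ≤ K * q ^ k := by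
    intro k
    induction k with
    | zero =>
      have hD : ∀ i, ‖scaledDiff p 0 i‖ ≤ B := fun i => by simpa [scaledDiff] using hB i
      have hDD : ∀ i j, ‖scaledDiff p 0 i - scaledDiff p 0 j‖ ≤ 2 * B := fun i j =>
        (norm_sub_le _ _).trans (by linarith [hD i, hD j])
      refine ⟨B, 4 * B, ⟨hD, fun i => (hDD _ _).trans (by linarith),
        fun i => (hDD _ _).trans (by linarith)⟩, by simp; linarith, ?_⟩
      have : 1 ≤ Real.exp (14 * (1 - q)⁻¹) :=
        Real.one_le_exp (by have : 0 < 1 - q := by linarith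
                            positivity)
      rw [pow_zero, mul_one]
      nlinarith
    | succ k ih =>
      obtain ⟨A, N, h, h1, h2⟩ := ih
      obtain ⟨hA, hN⟩ := h.nonneg
      have hle : A + 3 / 2 * N ≤ M := h1.trans (by
        rw [hM]; gcongr; exact sum_geometric_le hq0.le hq1 k)
      have hqk : 0 < q ^ k := by positivity
      refine ⟨_, _, h.refine (herr h) (scaledDiff_succ_even hp k) (scaledDiff_succ_odd hp k), ?_, ?_⟩
      · rw [Finset.sum_range_succ, mul_add (14 : ℝ), Real.exp_add, ← mul_assoc (7 * B)]
        have h3 := Real.add_one_le_exp (14 * q ^ k)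
        calc _ ≤ (A + 3 / 2 * N) * (14 * q ^ k + 1) := by nlinarith [mul_nonneg hqk.le hN]
          _ ≤ _ := by gcongr
      · have h4 : q ^ k * A ≤ q ^ k * M := by gcongr; linarith
        rw [pow_succ]
        nlinarith
  have hC : ∀ k : ℕ, ∃ A N, DiffBound (scaledDiff p k) A N ∧ N ≤ K * q ^ k ∧ A ≤ M := by
    intro k
    obtain ⟨A, N, h, h1, h2⟩ := hbound k
    refine ⟨A, N, h, h2, ?_⟩
    have : A + 3 / 2 * N ≤ M := h1.trans (by
      rw [hM]; gcongr; exact sum_geometric_le hq0.le hq1 k)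
    linarith [h.nonneg.2]
  have hdist : ∀ k i, dist (scaledDiff p (k + 1) (2 * i)) (scaledDiff p k i) ≤ (K + 2 * M) * q ^ k ∧
      dist (scaledDiff p (k + 1) (2 * i + 1)) (scaledDiff p k i) ≤ (K + 2 * M) * q ^ k := by
    intro k i
    obtain ⟨A, N, h, h1, h2⟩ := hC k
    have h3 := h.dist_le (herr h) (scaledDiff_succ_even hp k) (scaledDiff_succ_odd hp k) i
    have h4 : q ^ k * A ≤ q ^ k * M := by gcongr
    have h5 : 3 / 16 * N + 2 * (q ^ k * A) ≤ (K + 2 * M) * q ^ k := by linarith [h.nonneg.2]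
    exact ⟨h3.1.trans h5, h3.2.trans h5⟩
  refine ⟨K + 2 * M, fun k i => (hdist k i).1, fun k i => (hdist k i).2, fun k i => ?_⟩
  obtain ⟨A, N, h, h1, h2⟩ := hC k
  rw [dist_eq_norm]
  have : 0 ≤ q ^ k * M := by positivity
  linarith [h.second_le i]

end Decay

/-! ### The subdivision rule on the sphere and its limit curve -/

section Step

variable {n : ℕ}

theorem norm_coe_usphere (p : USphere n) : ‖(p : EuclideanSpace ℝ (Fin (n + 1)))‖ = 1 :=
  norm_eq_of_mem_sphere p

theorem energy_even (x : ℤ → USphere n) (l : ℤ) (p : USphere n) :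
    energy (fourPointMask (1 / 16)) x (2 * l) p = rdist p (x l) ^ 2 := by
  rw [energy, finsum_eq_single _ l]
  · simp [fourPointMask]
  · intro j hj
    have h : fourPointMask (1 / 16) (2 * l - 2 * j) = 0 := by
      rw [fourPointMask, if_neg (by omega), if_neg (by omega), if_neg (by omega)]
    rw [h, zero_mul]

theorem energy_odd (hn : 1 ≤ n) (x : ℤ → USphere n) (l : ℤ) (p : USphere n) :
    energy (fourPointMask (1 / 16)) x (2 * l + 1) p =
      fourPointEnergy (V := EuclideanSpace ℝ (Fin (n + 1)))
        (x (l - 1)) (x l) (x (l + 1)) (x (l + 2)) p := by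
  rw [energy, finsum_eq_sum_of_support_subset (s := {l - 1, l, l + 1, l + 2})]
  · have h1 : fourPointMask (1 / 16) (2 * l + 1 - 2 * (l - 1)) = -(1 / 16) := by
      rw [fourPointMask, if_neg (by omega), if_neg (by omega), if_pos (by omega)]
    have h2 : fourPointMask (1 / 16) (2 * l + 1 - 2 * l) = 9 / 16 := by
      rw [fourPointMask, if_neg (by omega), if_pos (by omega)]; norm_num
    have h3 : fourPointMask (1 / 16) (2 * l + 1 - 2 * (l + 1)) = 9 / 16 := by
      rw [fourPointMask, if_neg (by omega), if_pos (by omega)]; norm_num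
    have h4 : fourPointMask (1 / 16) (2 * l + 1 - 2 * (l + 2)) = -(1 / 16) := by
      rw [fourPointMask, if_neg (by omega), if_neg (by omega), if_pos (by omega)]
    rw [Finset.sum_insert (by simp; omega), Finset.sum_insert (by simp),
      Finset.sum_insert (by simp), Finset.sum_singleton, h1, h2, h3, h4]
    simp only [rdist_eq_angle hn, fourPointEnergy]
    ring
  · intro j hj
    by_contra hmem
    have hmem' : j ≠ l - 1 ∧ j ≠ l ∧ j ≠ l + 1 ∧ j ≠ l + 2 := by simpa using hmem
    apply hj
    have h : fourPointMask (1 / 16) (2 * l + 1 - 2 * j) = 0 := by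
      rw [fourPointMask, if_neg (by omega), if_neg (by omega), if_neg (by omega)]
    simp only [h, zero_mul]

theorem rdist_le_mesh (hn : 1 ≤ n) (x : ℤ → USphere n) (l : ℤ) :
    rdist (x l) (x (l + 1)) ≤ mesh x := by
  refine le_ciSup (f := fun l : ℤ => rdist (x l) (x (l + 1))) ⟨Real.pi, ?_⟩ l
  rintro _ ⟨j, rfl⟩
  simp only [rdist_eq_angle hn]
  exact angle_le_pi _ _

theorem unitQuadruple (hn : 1 ≤ n) (x : ℤ → USphere n) (l : ℤ) :
    UnitQuadruple (V := EuclideanSpace ℝ (Fin (n + 1)))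
      (x (l - 1)) (x l) (x (l + 1)) (x (l + 2)) (mesh x) := by
  refine ⟨norm_coe_usphere _, norm_coe_usphere _, norm_coe_usphere _, norm_coe_usphere _, ?_, ?_, ?_⟩
  · have := rdist_le_mesh hn x (l - 1)
    rwa [rdist_eq_angle hn, sub_add_cancel] at this
  · have := rdist_le_mesh hn x l
    rwa [rdist_eq_angle hn] at this
  · have := rdist_le_mesh hn x (l + 1)
    rwa [rdist_eq_angle hn, add_assoc, one_add_one_eq_two] at this

theorem isCenter_even_iff (hn : 1 ≤ n) (x : ℤ → USphere n) (l : ℤ) (p : USphere n) :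
    IsCenter (fourPointMask (1 / 16)) x (2 * l) p ↔ p = x l := by
  have hself : ∀ q : USphere n, rdist q q = 0 := fun q => by
    rw [rdist_eq_angle hn, angle_self (ne_zero_of_mem_unit_sphere q)]
  simp only [IsCenter, isMinOn_univ_iff, energy_even]
  constructor
  · intro h
    have h1 := h (x l)
    rw [hself, zero_pow two_ne_zero] at h1
    have h2 : rdist p (x l) = 0 := pow_eq_zero_iff two_ne_zero |>.1 (le_antisymm h1 (sq_nonneg _))
    rw [rdist_eq_angle hn] at h2
    exact Subtype.ext (eq_of_angle_eq_zero_of_norm_eq h2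
      ((norm_coe_usphere _).trans (norm_coe_usphere _).symm))
  · rintro rfl q
    rw [hself, zero_pow two_ne_zero]
    exact sq_nonneg _

theorem IsCenter.isMin (hn : 1 ≤ n) {x : ℤ → USphere n} {l : ℤ} {m : USphere n}
    (h : IsCenter (fourPointMask (1 / 16)) x (2 * l + 1) m) (p : EuclideanSpace ℝ (Fin (n + 1)))
    (hp : ‖p‖ = 1) :
    fourPointEnergy (V := EuclideanSpace ℝ (Fin (n + 1)))
        (x (l - 1)) (x l) (x (l + 1)) (x (l + 2)) m ≤
      fourPointEnergy (V := EuclideanSpace ℝ (Fin (n + 1)))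
        (x (l - 1)) (x l) (x (l + 1)) (x (l + 2)) p := by
  have := isMinOn_univ_iff.1 h ⟨p, mem_sphere_zero_iff_norm.2 hp⟩
  rwa [energy_odd hn, energy_odd hn] at this

theorem exists_isCenter_odd (hn : 1 ≤ n) (x : ℤ → USphere n) (l : ℤ) :
    ∃ p, IsCenter (fourPointMask (1 / 16)) x (2 * l + 1) p := by
  have hcont : ∀ q : USphere n, Continuous fun p : USphere n =>
      angle (p : EuclideanSpace ℝ (Fin (n + 1))) q := fun q =>
    continuous_iff_continuousAt.2 fun p =>
      ContinuousAt.comp (f := fun p : USphere n =>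
          ((p : EuclideanSpace ℝ (Fin (n + 1))), (q : EuclideanSpace ℝ (Fin (n + 1)))))
        (continuousAt_angle (ne_zero_of_mem_unit_sphere p) (ne_zero_of_mem_unit_sphere q))
        (by fun_prop)
  have he : Continuous (energy (fourPointMask (1 / 16)) x (2 * l + 1)) := by
    rw [show energy (fourPointMask (1 / 16)) x (2 * l + 1) = _ from funext (energy_odd hn x l)]
    have h1 := hcont (x (l - 1))
    have h2 := hcont (x l)
    have h3 := hcont (x (l + 1))
    have h4 := hcont (x (l + 2))
    unfold fourPointEnergy
    fun_prop
  obtain ⟨p, -, hp⟩ := isCompact_univ.exists_isMinOn ⟨x 0, mem_univ _⟩ he.continuousOn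
  exact ⟨p, hp⟩

theorem stepWellDefined (hn : 1 ≤ n) {x : ℤ → USphere n} (hx : mesh x < 31 / 100) :
    StepWellDefined (fourPointMask (1 / 16)) x := by
  intro i
  obtain ⟨l, rfl | rfl⟩ := Int.even_or_odd' i
  · exact ⟨x l, (isCenter_even_iff hn x l _).2 rfl, fun p hp => (isCenter_even_iff hn x l p).1 hp⟩
  · obtain ⟨p, hp⟩ := exists_isCenter_odd hn x l
    exact ⟨p, hp, fun p' hp' => Subtype.ext ((unitQuadruple hn x l).eq_of_isMin hx
      (norm_coe_usphere _) (norm_coe_usphere _) (hp'.isMin hn) (hp.isMin hn))⟩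

theorem isCenter_fourPointAnalogue (hn : 1 ≤ n) {x : ℤ → USphere n} (hx : mesh x < 31 / 100)
    (i : ℤ) : IsCenter (fourPointMask (1 / 16)) x i (fourPointAnalogue (1 / 16) x i) :=
  Classical.epsilon_spec (stepWellDefined hn hx i).exists

theorem fourPointAnalogue_even (hn : 1 ≤ n) {x : ℤ → USphere n} (hx : mesh x < 31 / 100) (l : ℤ) :
    fourPointAnalogue (1 / 16) x (2 * l) = x l :=
  (isCenter_even_iff hn x l _).1 (isCenter_fourPointAnalogue hn hx _)

theorem angle_fourPointAnalogue_odd_le (hn : 1 ≤ n) {x : ℤ → USphere n} (hx : mesh x < 31 / 100)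
    (l : ℤ) :
    angle (fourPointAnalogue (1 / 16) x (2 * l + 1) : EuclideanSpace ℝ (Fin (n + 1))) (x l)
        ≤ 24 / 25 * mesh x ∧
      angle (fourPointAnalogue (1 / 16) x (2 * l + 1) : EuclideanSpace ℝ (Fin (n + 1))) (x (l + 1))
        ≤ 24 / 25 * mesh x := by
  have hq := unitQuadruple hn x l
  have hm := (isCenter_fourPointAnalogue hn hx (2 * l + 1)).isMin hn
  refine ⟨hq.angle_le_of_isMin hx (norm_coe_usphere _) hm,
    hq.symm.angle_le_of_isMin hx (norm_coe_usphere _) ?_⟩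
  simpa only [fourPointEnergy_symm] using hm

theorem mesh_fourPointAnalogue_le (hn : 1 ≤ n) {x : ℤ → USphere n} (hx : mesh x < 31 / 100) :
    mesh (fourPointAnalogue (1 / 16) x) ≤ 24 / 25 * mesh x := by
  refine ciSup_le fun i => ?_
  rw [rdist_eq_angle hn]
  obtain ⟨l, rfl | rfl⟩ := Int.even_or_odd' i
  · rw [fourPointAnalogue_even hn hx, angle_comm]
    exact (angle_fourPointAnalogue_odd_le hn hx l).1
  · rw [show 2 * l + 1 + 1 = 2 * (l + 1) by ring, fourPointAnalogue_even hn hx]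
    exact (angle_fourPointAnalogue_odd_le hn hx l).2

theorem mesh_iterate_le (hn : 1 ≤ n) {x : ℤ → USphere n} (hx : mesh x < 31 / 100) (k : ℕ) :
    mesh ((fourPointAnalogue (1 / 16))^[k] x) ≤ (24 / 25) ^ k * mesh x ∧
      mesh ((fourPointAnalogue (1 / 16))^[k] x) < 31 / 100 := by
  have h0 : 0 ≤ mesh x := (unitQuadruple hn x 0).nonneg
  induction k with
  | zero => simpa using hx
  | succ k ih =>
    rw [Function.iterate_succ_apply']
    have h1 := mesh_fourPointAnalogue_le hn ih.2
    have h2 := (unitQuadruple hn ((fourPointAnalogue (1 / 16))^[k] x) 0).nonneg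
    refine ⟨?_, by linarith [ih.2]⟩
    rw [pow_succ]
    linarith [ih.1]

/-- Pointwise geometric closeness implies convergence in charts. -/
theorem convergesTo_of_dist_le {y : ℕ → ℤ → USphere n} {f : ℝ → USphere n} {ε : ℕ → ℝ}
    (hf : Continuous f) (hε : Tendsto ε atTop (𝓝 0))
    (h0 : ∀ (k : ℕ) (t : ℝ), dist (y k ⌊2 ^ k * t⌋) (f t) ≤ ε k)
    (h1 : ∀ (k : ℕ) (t : ℝ), dist (y k (⌊2 ^ k * t⌋ + 1)) (f t) ≤ ε k) : ConvergesTo y f := by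
  refine ⟨hf, fun e K hK hKe => ?_⟩
  have hfK : IsCompact (f '' K) := hK.image hf
  have hsub : f '' K ⊆ e.source := image_subset_iff.2 hKe
  constructor
  · obtain ⟨δ, hδ, hth⟩ := hfK.exists_thickening_subset_open e.open_source hsub
    filter_upwards [hε.eventually_lt_const hδ] with k hk t ht
    exact ⟨hth (Metric.mem_thickening_iff.2 ⟨f t, mem_image_of_mem f ht, (h0 k t).trans_lt hk⟩),
      hth (Metric.mem_thickening_iff.2 ⟨f t, mem_image_of_mem f ht, (h1 k t).trans_lt hk⟩)⟩
  · rw [Metric.tendstoUniformlyOn_iff]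
    intro r hr
    -- The chart is uniformly continuous at the compact set `f '' K` even when only one of the two
    -- points lies in it, as is the case for the data.
    have hu := hfK.uniformContinuousAt_of_continuousAt e
      (fun a ha => e.continuousAt (hsub ha)) (Metric.dist_mem_uniformity hr)
    obtain ⟨δ, hδ, hd⟩ := Metric.mem_uniformity_dist.1 hu
    filter_upwards [hε.eventually_lt_const hδ] with k hk t ht
    have hft := mem_image_of_mem f ht
    have hball : ∀ q : USphere n, dist q (f t) ≤ ε k → e q ∈ Metric.ball (e (f t)) r := by
      intro q hq
      rw [Metric.mem_ball']
      exact hd (by rw [dist_comm]; exact hq.trans_lt hk) hft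
    rw [dist_comm, ← Metric.mem_ball]
    exact (convex_ball _ _).lineMap_mem (hball _ (h0 k t)) (hball _ (h1 k t))
      ⟨Int.fract_nonneg _, (Int.fract_lt_one _).le⟩

theorem dist_le_of_angle_le {p q : USphere n} {r : ℝ}
    (h : angle (p : EuclideanSpace ℝ (Fin (n + 1))) q ≤ r) : dist p q ≤ r := by
  rw [Subtype.dist_eq, dist_eq_norm]
  exact (norm_sub_le_angle (norm_coe_usphere _) (norm_coe_usphere _)).trans h

theorem exists_contDiff_limit (hn : 1 ≤ n) {x : ℤ → USphere n} (hx : mesh x < 31 / 100) :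
    ∃ f : ℝ → USphere n, ConvergesTo (fun k => (fourPointAnalogue (1 / 16))^[k] x) f ∧
      ContDiff ℝ 1 (fun t => (f t : EuclideanSpace ℝ (Fin (n + 1)))) := by
  set y : ℕ → ℤ → USphere n := fun k => (fourPointAnalogue (1 / 16))^[k] x with hy
  have hsucc : ∀ k, y (k + 1) = fourPointAnalogue (1 / 16) (y k) := fun k =>
    Function.iterate_succ_apply' _ _ _
  have hmesh : ∀ k, mesh (y k) < 31 / 100 := fun k => (mesh_iterate_le hn hx k).2
  have hmeshk : ∀ k, mesh (y k) ≤ mesh x * (24 / 25) ^ k := fun k =>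
    (mesh_iterate_le hn hx k).1.trans_eq (mul_comm _ _)
  have hmesh0 : ∀ k, 0 ≤ mesh (y k) := fun k => (unitQuadruple hn (y k) 0).nonneg
  have heven : ∀ k i, y (k + 1) (2 * i) = y k i := fun k i => by
    rw [hsucc, fourPointAnalogue_even hn (hmesh k)]
  have hstep : ∀ k i, dist (y k (i + 1)) (y k i) ≤ mesh x * (24 / 25) ^ k := fun k i => by
    rw [dist_comm]
    exact (dist_le_of_angle_le ((rdist_eq_angle hn _ _).symm.trans_le
      (rdist_le_mesh hn (y k) i))).trans (hmeshk k)
  obtain ⟨f, hf, hfy⟩ := exists_continuous_dyadic_limit (a := y) (C := mesh x) (r := 24 / 25)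
    (by norm_num) (by norm_num)
    (fun k i => by rw [heven, dist_self]; exact (hmesh0 k).trans (hmeshk k))
    (fun k i => by
      rw [hsucc]
      refine (dist_le_of_angle_le (angle_fourPointAnalogue_odd_le hn (hmesh k) i).1).trans ?_
      linarith [hmeshk k, hmesh0 k])
    hstep
  refine ⟨f, ?_, ?_⟩
  · have hlim : Tendsto (fun k : ℕ => mesh x * (24 / 25 : ℝ) ^ k +
        mesh x * (24 / 25) ^ k / (1 - 24 / 25)) atTop (𝓝 0) := by
      have h := (tendsto_pow_atTop_nhds_zero_of_lt_one (r := (24 / 25 : ℝ)) (by norm_num)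
        (by norm_num)).const_mul (mesh x)
      rw [mul_zero] at h
      simpa using h.add (h.div_const (1 - 24 / 25))
    refine convergesTo_of_dist_le hf hlim (fun k t => (hfy k t).trans ?_) (fun k t => ?_)
    · linarith [hmeshk k, hmesh0 k]
    · exact (dist_triangle _ _ _).trans (add_le_add (hstep k _) (hfy k t))
  · set p : ℕ → ℤ → EuclideanSpace ℝ (Fin (n + 1)) := fun k i => y k i with hp
    have hpe : ∀ k i, p (k + 1) (2 * i) = p k i := fun k i => by simp only [hp, heven]
    obtain ⟨C, hC0, hC1, hC2⟩ := exists_geometric_decay (p := p) (q := 24 / 25) (B := mesh x)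
      (by norm_num) (by norm_num) hpe
      (fun i => by
        have := hstep 0 i
        rwa [pow_zero, mul_one, Subtype.dist_eq, dist_eq_norm] at this)
      (fun k b hb i => by
        have hprox := (unitQuadruple hn (y k) i).norm_sub_fourPointAverage_le (hmesh k)
          (norm_coe_usphere _) ((isCenter_fourPointAnalogue hn (hmesh k) (2 * i + 1)).isMin hn)
        rw [← hsucc] at hprox
        refine hprox.trans ?_
        -- Chords are at most `0.31`, so an angle exceeds its chord by less than the factor `21/20`.
        have hmb : mesh (y k) ≤ 21 / 20 * b := by
          refine ciSup_le fun j => ?_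
          rw [rdist_eq_angle hn]
          have h1 := hb j
          rw [norm_sub_rev] at h1
          have h2 : ‖p k j - p k (j + 1)‖ ≤ 31 / 100 :=
            (norm_sub_le_angle (norm_coe_usphere _) (norm_coe_usphere _)).trans
              ((rdist_eq_angle hn _ _).symm.trans_le ((rdist_le_mesh hn (y k) j).trans (hmesh k).le))
          have h3 := angle_le_mul_norm_sub (norm_coe_usphere (y k j)) (norm_coe_usphere (y k (j + 1)))
            h2
          have h4 := angle_nonneg (p k j) (p k (j + 1))
          simp only [hp] at h1 h4
          linarith
        have hpow : (0 : ℝ) < (24 / 25) ^ k := by positivity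
        have h5 : mesh (y k) ≤ 31 / 100 * (24 / 25) ^ k :=
          (hmeshk k).trans (by gcongr)
        -- One factor of the squared mesh supplies the decay `(24/25)^k`, the other the bound by
        -- `b`.
        calc 93 / 100 * mesh (y k) ^ 2
            ≤ 93 / 100 * ((31 / 100 * (24 / 25) ^ k) * (21 / 20 * b)) := by
              rw [sq]
              have := hmesh0 k
              gcongr
          _ ≤ (24 / 25) ^ k * b := by
              have hb0 : 0 ≤ b := by linarith [hmesh0 k]
              nlinarith [mul_nonneg hpow.le hb0])
    obtain ⟨g, hg, hgD⟩ := exists_continuous_dyadic_limit (a := scaledDiff p) (r := 24 / 25)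
      (by norm_num) (by norm_num) hC0 hC1 hC2
    refine contDiff_one_of_dyadic_differences (p := p) (g := g) (C := C / (1 - 24 / 25))
      (r := 24 / 25) (by norm_num) (by norm_num) (continuous_subtype_val.comp hf) hg
      (fun k i => ?_) (fun k t => (hgD k t).trans_eq (by ring))
    simp only [hp]
    rw [dyadic_limit_apply (by norm_num) (by norm_num) heven hfy]

end Step

end SphereSubdivision

theorem mainTheorem2 :
    ∃ μ : ℝ, 0 < μ ∧ μ < 1 ∧ ∃ C : ℝ, 0 < C ∧
      ∀ n : ℕ, 2 ≤ n → ∀ x : ℤ → SphereSubdivision.USphere n,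
        SphereSubdivision.mesh x < 0.31 →
        -- all iterates are well defined
        (∀ k : ℕ, SphereSubdivision.StepWellDefined (SphereSubdivision.fourPointMask (1 / 16))
          ((SphereSubdivision.fourPointAnalogue (1 / 16))^[k] x)) ∧
        -- contractivity
        (∀ (k : ℕ) (i : ℤ),
          SphereSubdivision.rdist
              ((SphereSubdivision.fourPointAnalogue (1 / 16))^[k] x (i + 1))
              ((SphereSubdivision.fourPointAnalogue (1 / 16))^[k] x i)
            ≤ μ ^ k * SphereSubdivision.mesh x) ∧
        -- displacement-safe
        (∀ i : ℤ,
          SphereSubdivision.rdist (SphereSubdivision.fourPointAnalogue (1 / 16) x (2 * i)) (x i)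
            ≤ C * SphereSubdivision.mesh x) ∧
        -- convergence to a continuous limit, which is of class C¹
        ∃ f : ℝ → SphereSubdivision.USphere n,
          SphereSubdivision.ConvergesTo
            (fun k => (SphereSubdivision.fourPointAnalogue (1 / 16))^[k] x) f ∧
          ContDiff ℝ 1 (fun t => (f t : EuclideanSpace ℝ (Fin (n + 1)))) := by
  open SphereSubdivision in
  -- The scheme is interpolatory, so the displacement vanishes and any positive constant would serve
  -- in place of `1`.
  refine ⟨24 / 25, by norm_num, by norm_num, 1, one_pos, fun n hn2 x hx' => ?_⟩
  have hn : 1 ≤ n := by omega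
  have hx : mesh x < 31 / 100 := by norm_num at hx' ⊢; exact hx'
  refine ⟨fun k => stepWellDefined hn (mesh_iterate_le hn hx k).2, fun k i => ?_, fun i => ?_,
    exists_contDiff_limit hn hx⟩
  · rw [rdist_eq_angle hn, InnerProductGeometry.angle_comm, ← rdist_eq_angle hn]
    exact (rdist_le_mesh hn _ i).trans (mesh_iterate_le hn hx k).1
  · rw [fourPointAnalogue_even hn hx, rdist_eq_angle hn,
      InnerProductGeometry.angle_self (ne_zero_of_mem_unit_sphere _), one_mul]
    exact (unitQuadruple hn x 0).nonneg
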